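/- Let $\Lambda$ be an artin algebra, that is, an algebra over a commutative artinian ring $R$ that is finitely generated as an $R$-module. All modules are finitely generated left modules, and $D=\operatorname{Hom}_R(-,J)$, where $J$ is an injective envelope of $R/\operatorname{rad}R$. Let $\widetilde Q$ be the direct sum of representatives of the isomorphism classes of all indecomposable projective-injective $\Lambda$-modules, and let $\mathcal C_\Lambda$ be the full subcategory of all $\Lambda$-modules $M$ for which there are an epimorphism $\widetilde Q^{m}\to M$ and a monomorphism $M\to\widetilde Q^{m'}$ for some $m,m'\ge 0$. The category $\mathcal C_{\Lambda^{op}}$ is defined in the same way over the opposite algebra $\Lambda^{op}$. The dominant dimension $\operatorname{dom.dim}\Lambda$ is the supremum of all $k$ such that $I_0,\dots,I_{k-1}$ are projective, where $0\to\Lambda\to I_0\to I_1\to\cdots$ is a minimal injective resolution of the left $\Lambda$-module $\Lambda$. A basic $\Lambda$-module $T$ (a finite direct sum of pairwise non-isomorphic indecomposable modules) is *tilting* if $\operatorname{pd}T\le 1$, $\operatorname{Ext}^1_\Lambda(T,T)=0$, and there is an exact sequence $0\to\Lambda\to T_0\to T_1\to 0$ with $T_0,T_1\in\operatorname{add}T$.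 A $\Lambda$-module $C$ is *cotilting* if $\operatorname{id}C\le 1$, $\operatorname{Ext}^1_\Lambda(C,C)=0$, and there is an exact sequence $0\to C_0\to C_1\to D\Lambda\to 0$ with $C_0,C_1\in\operatorname{add}C$. Then the following statements are equivalent: (a) $\operatorname{dom.dim}\Lambda\ge 2$; (b) $\mathcal C_\Lambda$ contains a tilting $\Lambda$-module; (c) $\mathcal C_\Lambda$ contains a cotilting $\Lambda$-module; (d) $\mathcal C_{\Lambda^{op}}$ contains a tilting $\Lambda^{op}$-module; (e) $\operatorname{dom.dim}\Lambda^{op}\ge 2$. -/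

import Mathlib

open CategoryTheory

universe u

namespace ArtinTilting

noncomputable section

section Modules

variable (A : Type u) [Ring A]

/-- A module is indecomposable if it is nonzero and is not the direct sum of two nonzero
submodules. -/
def Indecomposable (M : Type u) [AddCommGroup M] [Module A M] : Prop :=
  Nontrivial M ∧ ∀ N₁ N₂ : Submodule A M, IsCompl N₁ N₂ → N₁ = ⊥ ∨ N₂ = ⊥

/-- A module is basic if it is a finite direct sum of pairwise non-isomorphic indecomposable
modules. -/
def IsBasic (M : Type u) [AddCommGroup M] [Module A M] : Prop :=
  ∃ (n : ℕ) (X : Fin n → ModuleCat.{u} A),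
    (∀ i, Indecomposable A (X i)) ∧
    (∀ i j, Nonempty (X i ≃ₗ[A] X j) → i = j) ∧
    Nonempty (M ≃ₗ[A] (∀ i, X i))

/-- `M` is generated by `X`: there is an epimorphism `X ^ m → M` for some `m`. -/
def Gen (X M : Type u) [AddCommGroup X] [Module A X] [AddCommGroup M] [Module A M] : Prop :=
  ∃ (m : ℕ) (f : (Fin m → X) →ₗ[A] M), Function.Surjective f

/-- `M` is cogenerated by `X`: there is a monomorphism `M → X ^ m` for some `m`. -/
def Cogen (X M : Type u) [AddCommGroup X] [Module A X] [AddCommGroup M] [Module A M] : Prop :=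
  ∃ (m : ℕ) (f : M →ₗ[A] (Fin m → X)), Function.Injective f

/-- `M` lies in `add X`: it is a direct summand of `X ^ m` for some `m`. -/
def InAdd (X M : Type u) [AddCommGroup X] [Module A X] [AddCommGroup M] [Module A M] : Prop :=
  ∃ (m : ℕ) (i : M →ₗ[A] (Fin m → X)) (p : (Fin m → X) →ₗ[A] M), p ∘ₗ i = LinearMap.id

/-- The finite family `Q` is a set of representatives of the isomorphism classes of all
(finitely generated) indecomposable projective-injective modules. -/
structure IsProjInjReps {t : ℕ} (Q : Fin t → ModuleCat.{u} A) : Prop where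
  finite : ∀ i, Module.Finite A (Q i)
  indecomposable : ∀ i, Indecomposable A (Q i)
  projective : ∀ i, Module.Projective A (Q i)
  injective : ∀ i, Module.Injective A (Q i)
  eq_of_iso : ∀ i j, Nonempty (Q i ≃ₗ[A] Q j) → i = j
  exists_iso : ∀ M : ModuleCat.{u} A, Module.Finite A M → Indecomposable A M →
    Module.Projective A M → Module.Injective A M → ∃ i, Nonempty (M ≃ₗ[A] Q i)

/-- The subcategory `C_A`: finitely generated modules that are generated and cogenerated by the
direct sum of representatives of all indecomposable projective-injective modules (a finite direct
sum of modules is their product; it does not depend on the representatives up to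
isomorphism). -/
def MemC (M : Type u) [AddCommGroup M] [Module A M] : Prop :=
  Module.Finite A M ∧ ∃ (t : ℕ) (Q : Fin t → ModuleCat.{u} A),
    IsProjInjReps A Q ∧ Gen A (∀ i, Q i) M ∧ Cogen A (∀ i, Q i) M

/-- A submodule is essential if it meets every nonzero submodule nontrivially. -/
def IsEssential {M : Type u} [AddCommGroup M] [Module A M] (N : Submodule A M) : Prop :=
  ∀ K : Submodule A M, N ⊓ K = ⊥ → K = ⊥

/-- `f : M → E` is an injective envelope of `M`. -/
structure IsInjectiveEnvelope {M E : Type u} [AddCommGroup M] [Module A M] [AddCommGroup E]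
    [Module A E] (f : M →ₗ[A] E) : Prop where
  injective_module : Module.Injective A E
  injective : Function.Injective f
  essential : IsEssential A (LinearMap.range f)

/-- A minimal injective resolution `0 → M → I₀ → I₁ → ⋯` of `M`. -/
structure MinimalInjectiveResolution (M : Type u) [AddCommGroup M] [Module A M] where
  /-- The terms. -/
  I : ℕ → ModuleCat.{u} A
  /-- The augmentation. -/
  ε : M →ₗ[A] I 0
  /-- The differentials. -/
  d : ∀ n, I n →ₗ[A] I (n + 1)
  injective_module : ∀ n, Module.Injective A (I n)
  injective_ε : Function.Injective ε
  exact_zero : Function.Exact ε (d 0)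
  exact_succ : ∀ n, Function.Exact (d n) (d (n + 1))
  essential_ε : IsEssential A (LinearMap.range ε)
  essential_d : ∀ n, IsEssential A (LinearMap.range (d n))

/-- The dominant dimension of `M`: the supremum of all `k` such that the terms `I₀, …, I_{k-1}` of
a minimal injective resolution of `M` (unique up to isomorphism) are projective. -/
def moduleDomDim (M : Type u) [AddCommGroup M] [Module A M] : ℕ∞ :=
  sSup {k : ℕ∞ | ∃ (S : MinimalInjectiveResolution A M) (n : ℕ),
    k = n ∧ ∀ i < n, Module.Projective A (S.I i)}

/-- The (left) dominant dimension of the ring `A`. -/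
def domDim : ℕ∞ := moduleDomDim A A

/-- Classical tilting modules. -/
structure IsTilting (T : Type u) [AddCommGroup T] [Module A T] : Prop where
  finite : Module.Finite A T
  basic : IsBasic A T
  projectiveDimension_le_one : HasProjectiveDimensionLE (ModuleCat.of A T) 1
  ext_eq_zero : Subsingleton (Abelian.Ext.{u} (ModuleCat.of A T) (ModuleCat.of A T) 1)
  exists_coresolution : ∃ (T₀ T₁ : ModuleCat.{u} A) (f : A →ₗ[A] T₀) (g : T₀ →ₗ[A] T₁),
    InAdd A T T₀ ∧ InAdd A T T₁ ∧
    Function.Injective f ∧ Function.Exact f g ∧ Function.Surjective g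

end Modules

section Cotilting

variable (R A : Type u) [CommRing R] [Ring A] [Algebra R A]

/-- The `R`-module `Hom_R(A, J)`, to be made a left `A`-module through the right action of `A` on
itself. For `J` an injective envelope of `R / rad R` this is the dual `DA`. -/
def Dual (J : Type u) [AddCommGroup J] [Module R J] : Type u := A →ₗ[R] J

instance (J : Type u) [AddCommGroup J] [Module R J] : AddCommGroup (Dual R A J) :=
  inferInstanceAs (AddCommGroup (A →ₗ[R] J))

instance (J : Type u) [AddCommGroup J] [Module R J] : Module A (Dual R A J) where
  smul a f := LinearMap.comp (show A →ₗ[R] J from f) (LinearMap.mulRight R a)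
  one_smul f := LinearMap.ext fun x => congrArg (show A →ₗ[R] J from f) (mul_one x)
  mul_smul a b f :=
    LinearMap.ext fun x => congrArg (show A →ₗ[R] J from f) (mul_assoc x a b).symm
  smul_zero _ := rfl
  smul_add _ _ _ := rfl
  add_smul a b f := LinearMap.ext fun x =>
    (congrArg (show A →ₗ[R] J from f) (mul_add x a b)).trans
      (map_add (show A →ₗ[R] J from f) (x * a) (x * b))
  zero_smul f := LinearMap.ext fun x =>
    (congrArg (show A →ₗ[R] J from f) (mul_zero x)).trans (map_zero (show A →ₗ[R] J from f))

/-- The action on the dual is `(a • f) x = f (x a)`. -/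
theorem Dual.smul_apply (J : Type u) [AddCommGroup J] [Module R J] (a : A) (f : Dual R A J)
    (x : A) : (show A →ₗ[R] J from a • f) x = (show A →ₗ[R] J from f) (x * a) := rfl

/-- Classical cotilting modules over the artin `R`-algebra `A`. -/
structure IsCotilting (C : Type u) [AddCommGroup C] [Module A C] : Prop where
  finite : Module.Finite A C
  injectiveDimension_le_one : HasInjectiveDimensionLE (ModuleCat.of A C) 1
  ext_eq_zero : Subsingleton (Abelian.Ext.{u} (ModuleCat.of A C) (ModuleCat.of A C) 1)
  exists_resolution : ∃ (J : ModuleCat.{u} R) (j : (R ⧸ Ring.jacobson R) →ₗ[R] J),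
    IsInjectiveEnvelope R j ∧
    ∃ (C₀ C₁ : ModuleCat.{u} A) (f : C₀ →ₗ[A] C₁) (g : C₁ →ₗ[A] Dual R A J),
      InAdd A C C₀ ∧ InAdd A C C₁ ∧
      Function.Injective f ∧ Function.Exact f g ∧ Function.Surjective g

end Cotilting

end

end ArtinTilting

namespace ArtinTilting

/-! ### Closure properties of `Gen`, `Cogen` and `InAdd` -/

section Closure

variable {A : Type u} [Ring A] {X Y M N : Type u} [AddCommGroup X] [Module A X]
  [AddCommGroup Y] [Module A Y] [AddCommGroup M] [Module A M] [AddCommGroup N] [Module A N]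

/-! Write Q for the sum of the indecomposable projective-injectives. Dominant dimension at least 2
means that there is an exact sequence 0 → Λ → Q₀ → Q₁ with finitely generated projective-injective
terms (`two_le_domDim_iff`), and everything is compared with this copresentation.

From a copresentation, let C be the cokernel of Λ → Q₀. Then Q ⊕ C lies in the subcategory and has
projective dimension at most 1. It has no self-extensions: a map from Λ to a module generated by Q
lifts to a power of Q, Λ being projective, and then extends to the middle term, powers of Q being
injective (`exists_lift_of_gen`). A basic summand with the same additive closure is the tilting
module.

Conversely, let T be tilting in the subcategory, and embed Λ in a power of Q with cokernel C. As
Ext¹(T, Q) = 0, T generates Q, hence C. The kernel of a right T-approximation Tⁿ → C has no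
extensions by T, so it is generated by T and hence by Q; the same lifting argument then splits the
approximation. So C embeds in Tⁿ, hence in a power of Q, and a copresentation results
(`hasProjInjCopresentation_of_extZero`). Dually, a cotilting module in the subcategory amounts to a
presentation Q₁ → Q₀ → DΛ → 0 by projective-injectives.

The two sides are joined by the double centralizer property. A copresentation forces Λ to be the
double centralizer of Q₀ ⊕ Q₁, which by Matlis duality gives a presentation of DΛ by powers of that
module (`exists_presentation_of_hasDoubleCentralizer`). Applying D turns this into a copresentation
of Λᵒᵖ (`hasProjInjCopresentation_opposite`). Running the argument again from Λᵒᵖ closes the cycle.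
-/

theorem gen_of_finite {ι : Type} [Finite ι] (f : (ι → X) →ₗ[A] M) (hf : Function.Surjective f) :
    Gen A X M := by
  obtain ⟨n, ⟨e⟩⟩ := Finite.exists_equiv_fin ι
  exact ⟨n, f ∘ₗ (LinearEquiv.funCongrLeft A X e).toLinearMap,
    hf.comp (LinearEquiv.funCongrLeft A X e).surjective⟩

theorem cogen_of_finite {ι : Type} [Finite ι] (f : M →ₗ[A] (ι → X))
    (hf : Function.Injective f) : Cogen A X M := by
  obtain ⟨n, ⟨e⟩⟩ := Finite.exists_equiv_fin ι
  exact ⟨n, (LinearEquiv.funCongrLeft A X e.symm).toLinearMap ∘ₗ f,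
    (LinearEquiv.funCongrLeft A X e.symm).injective.comp hf⟩

theorem inAdd_of_finite {ι : Type} [Finite ι] (i : M →ₗ[A] (ι → X)) (p : (ι → X) →ₗ[A] M)
    (h : p ∘ₗ i = LinearMap.id) : InAdd A X M := by
  obtain ⟨n, ⟨e⟩⟩ := Finite.exists_equiv_fin ι
  refine ⟨n, (LinearEquiv.funCongrLeft A X e.symm).toLinearMap ∘ₗ i,
    p ∘ₗ (LinearEquiv.funCongrLeft A X e).toLinearMap, ?_⟩
  ext x
  have : (LinearEquiv.funCongrLeft A X e) ((LinearEquiv.funCongrLeft A X e.symm) (i x)) = i x := by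
    ext j; simp [LinearEquiv.funCongrLeft_apply]
  simpa only [LinearMap.comp_apply, LinearEquiv.coe_coe, this] using LinearMap.congr_fun h x

theorem Gen.of_surjective (h : Gen A X M) (f : M →ₗ[A] N) (hf : Function.Surjective f) :
    Gen A X N := by
  obtain ⟨m, g, hg⟩ := h
  exact ⟨m, f ∘ₗ g, hf.comp hg⟩

theorem Cogen.of_injective (h : Cogen A X N) (f : M →ₗ[A] N) (hf : Function.Injective f) :
    Cogen A X M := by
  obtain ⟨m, g, hg⟩ := h
  exact ⟨m, g ∘ₗ f, hg.comp hf⟩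

theorem InAdd.of_retract (h : InAdd A X N) (i : M →ₗ[A] N) (p : N →ₗ[A] M)
    (hp : p ∘ₗ i = LinearMap.id) : InAdd A X M := by
  obtain ⟨m, j, q, hq⟩ := h
  refine ⟨m, j ∘ₗ i, p ∘ₗ q, ?_⟩
  rw [LinearMap.comp_assoc, ← LinearMap.comp_assoc i, hq, LinearMap.id_comp, hp]

theorem InAdd.gen (h : InAdd A X M) : Gen A X M := by
  obtain ⟨m, i, p, hp⟩ := h
  exact ⟨m, p, fun x => ⟨i x, LinearMap.congr_fun hp x⟩⟩

theorem InAdd.cogen (h : InAdd A X M) : Cogen A X M := by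
  obtain ⟨m, i, p, hp⟩ := h
  exact ⟨m, i, Function.LeftInverse.injective (g := p) fun x => LinearMap.congr_fun hp x⟩

theorem inAdd_self : InAdd A X X :=
  inAdd_of_finite (ι := Unit) (LinearMap.pi fun _ => LinearMap.id) (LinearMap.proj ())
    (by ext; simp)

theorem inAdd_of_retract (i : M →ₗ[A] X) (p : X →ₗ[A] M) (hp : p ∘ₗ i = LinearMap.id) :
    InAdd A X M :=
  inAdd_self.of_retract i p hp

theorem inAdd_of_equiv (e : M ≃ₗ[A] X) : InAdd A X M :=
  inAdd_of_retract e.toLinearMap e.symm.toLinearMap (by ext; simp)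

section Pi

/-- Flattening a finite family of finite powers. -/
def sigmaPowLinearMap (A : Type u) [Ring A] {ι : Type} (m : ι → ℕ) (X : Type u) [AddCommGroup X]
    [Module A X] : ((Σ i, Fin (m i)) → X) ≃ₗ[A] (∀ i, Fin (m i) → X) :=
  LinearEquiv.piCurry A (fun _ _ => X)

theorem gen_pi {ι : Type} [Finite ι] {F : ι → Type u} [∀ i, AddCommGroup (F i)]
    [∀ i, Module A (F i)] (h : ∀ i, Gen A X (F i)) : Gen A X (∀ i, F i) := by
  choose m f hf using h
  refine gen_of_finite ((LinearMap.pi fun i => f i ∘ₗ LinearMap.proj i) ∘ₗ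
    (sigmaPowLinearMap A m X).toLinearMap) ?_
  rw [LinearMap.coe_comp]
  refine Function.Surjective.comp ?_ (LinearEquiv.surjective _)
  intro y
  choose x hx using fun i => hf i (y i)
  exact ⟨x, funext hx⟩

theorem cogen_pi {ι : Type} [Finite ι] {F : ι → Type u} [∀ i, AddCommGroup (F i)]
    [∀ i, Module A (F i)] (h : ∀ i, Cogen A X (F i)) : Cogen A X (∀ i, F i) := by
  choose m f hf using h
  refine cogen_of_finite ((sigmaPowLinearMap A m X).symm.toLinearMap ∘ₗ
    (LinearMap.pi fun i => f i ∘ₗ LinearMap.proj i)) ?_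
  rw [LinearMap.coe_comp]
  refine Function.Injective.comp (LinearEquiv.injective _) ?_
  intro x y hxy
  exact funext fun i => hf i (congrFun hxy i)

theorem inAdd_pi {ι : Type} [Finite ι] {F : ι → Type u} [∀ i, AddCommGroup (F i)]
    [∀ i, Module A (F i)] (h : ∀ i, InAdd A X (F i)) : InAdd A X (∀ i, F i) := by
  choose m f g hf using h
  refine inAdd_of_finite ((sigmaPowLinearMap A m X).symm.toLinearMap ∘ₗ
    (LinearMap.pi fun i => f i ∘ₗ LinearMap.proj i))
    ((LinearMap.pi fun i => g i ∘ₗ LinearMap.proj i) ∘ₗ (sigmaPowLinearMap A m X).toLinearMap) ?_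
  refine LinearMap.ext fun x => funext fun i => ?_
  simpa using LinearMap.congr_fun (hf i) (x i)

end Pi

theorem Gen.trans (h : Gen A X Y) (h' : Gen A Y M) : Gen A X M := by
  obtain ⟨m, f, hf⟩ := h'
  exact (gen_pi (F := fun _ : Fin m => Y) fun _ => h).of_surjective f hf

theorem Cogen.trans (h : Cogen A X Y) (h' : Cogen A Y M) : Cogen A X M := by
  obtain ⟨m, f, hf⟩ := h'
  exact (cogen_pi (F := fun _ : Fin m => Y) fun _ => h).of_injective f hf

theorem InAdd.trans (h : InAdd A X Y) (h' : InAdd A Y M) : InAdd A X M := by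
  obtain ⟨m, i, p, hp⟩ := h'
  exact (inAdd_pi (F := fun _ : Fin m => Y) fun _ => h).of_retract i p hp

theorem gen_prod (h : Gen A X M) (h' : Gen A X N) : Gen A X (M × N) := by
  obtain ⟨m, f, hf⟩ := h
  obtain ⟨n, g, hg⟩ := h'
  exact gen_of_finite (ι := Fin m ⊕ Fin n)
    (f.prodMap g ∘ₗ (LinearEquiv.sumArrowLequivProdArrow (Fin m) (Fin n) A X).toLinearMap)
    (by
      rw [LinearMap.coe_comp]
      exact Function.Surjective.comp (hf.prodMap hg) (LinearEquiv.surjective _))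

theorem cogen_prod (h : Cogen A X M) (h' : Cogen A X N) : Cogen A X (M × N) := by
  obtain ⟨m, f, hf⟩ := h
  obtain ⟨n, g, hg⟩ := h'
  exact cogen_of_finite (ι := Fin m ⊕ Fin n)
    ((LinearEquiv.sumArrowLequivProdArrow (Fin m) (Fin n) A X).symm.toLinearMap ∘ₗ f.prodMap g)
    (by
      rw [LinearMap.coe_comp]
      exact Function.Injective.comp (LinearEquiv.injective _) (hf.prodMap hg))

/-- The map from a power of `X` given by a finite family of maps. -/
def coprodMap {n : ℕ} (h : Fin n → (X →ₗ[A] M)) : (Fin n → X) →ₗ[A] M :=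
  ∑ i, h i ∘ₗ LinearMap.proj i

theorem coprodMap_comp_pi {n : ℕ} (h : Fin n → (X →ₗ[A] M)) (b : Fin n → (Y →ₗ[A] X)) :
    coprodMap h ∘ₗ LinearMap.pi b = ∑ i, h i ∘ₗ b i := by
  ext x
  simp [coprodMap]

theorem coprodMap_comp_single {n : ℕ} (h : Fin n → (X →ₗ[A] M)) (j : Fin n) :
    coprodMap h ∘ₗ LinearMap.single A (fun _ => X) j = h j := by
  ext x
  simp only [coprodMap, LinearMap.comp_apply, LinearMap.coe_sum, Finset.sum_apply,
    LinearMap.proj_apply, LinearMap.coe_single]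
  rw [Finset.sum_eq_single j (fun k _ hk => by simp [Pi.single_eq_of_ne hk]) (by simp)]
  simp

/-- A finitely generated module is generated by `X` as soon as each element is in the image of a
finite power of `X`. -/
theorem gen_of_forall_mem_range [Module.Finite A M]
    (h : ∀ x : M, ∃ (k : ℕ) (f : (Fin k → X) →ₗ[A] M), x ∈ LinearMap.range f) : Gen A X M := by
  obtain ⟨n, s, hs⟩ := Module.Finite.exists_fin (R := A) (M := M)
  choose k f y hy using fun i => h (s i)
  refine (gen_pi (F := fun i : Fin n => Fin (k i) → X) fun i => gen_pi (F := fun _ => X)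
    fun _ => inAdd_self.gen).of_surjective (∑ i, f i ∘ₗ LinearMap.proj i) ?_
  rw [← LinearMap.range_eq_top, eq_top_iff, ← hs, Submodule.span_le]
  rintro _ ⟨i, rfl⟩
  refine ⟨Pi.single i (y i), ?_⟩
  simp only [LinearMap.coe_sum, Finset.sum_apply, LinearMap.comp_apply, LinearMap.proj_apply]
  rw [Finset.sum_eq_single i]
  · simpa using hy i
  · intro j _ hj
    simp [Pi.single_eq_of_ne hj]
  · simp

/-- An artinian module is cogenerated by `X` as soon as maps to `X` separate its points. -/
theorem cogen_of_forall_ne_zero [IsArtinian A M]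
    (h : ∀ x : M, x ≠ 0 → ∃ f : M →ₗ[A] X, f x ≠ 0) : Cogen A X M := by
  -- Take a map to a power of `X` with minimal kernel; a nonzero kernel element could be detected by
  -- one more coordinate.
  obtain ⟨_, ⟨n, f, rfl⟩, hmin⟩ := IsArtinian.set_has_minimal
    {K : Submodule A M | ∃ (n : ℕ) (f : M →ₗ[A] (Fin n → X)), K = LinearMap.ker f}
    ⟨_, 0, 0, rfl⟩
  refine ⟨n, f, ?_⟩
  rw [← LinearMap.ker_eq_bot, Submodule.eq_bot_iff]
  intro x hx
  by_contra hx0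
  obtain ⟨g, hg⟩ := h x hx0
  let f' : M →ₗ[A] (Fin (n + 1) → X) := LinearMap.pi (Fin.cons (α := fun _ => M →ₗ[A] X) g
    fun i => LinearMap.proj i ∘ₗ f)
  have hk : LinearMap.ker f' = LinearMap.ker g ⊓ LinearMap.ker f := by
    ext y
    simp [f', LinearMap.mem_ker, funext_iff, Fin.forall_fin_succ]
  refine hmin _ ⟨n + 1, f', rfl⟩ ?_
  rw [hk]
  exact lt_of_le_of_ne inf_le_right fun h => hg (h.ge hx).1

end Closure

/-! ### Finite generation of Hom over an artin algebra -/

section Finiteness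

variable {A : Type u} [Ring A] {M N : Type u} [AddCommGroup M] [Module A M] [AddCommGroup N]
  [Module A N]

/-- Over an artin algebra, homomorphisms between finitely generated modules are finitely generated
over both endomorphism rings. -/
theorem exists_hom_generators (R : Type u) [CommRing R] [IsArtinianRing R] [Algebra R A]
    [Module.Finite R A] [Module.Finite A M] [Module.Finite A N] :
    ∃ (n : ℕ) (h : Fin n → (M →ₗ[A] N)), ∀ f : M →ₗ[A] N,
      (∃ b : Fin n → (N →ₗ[A] N), f = ∑ i, b i ∘ₗ h i) ∧
      (∃ b : Fin n → (M →ₗ[A] M), f = ∑ i, h i ∘ₗ b i) := by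
  let _ : Module R M := Module.compHom M (algebraMap R A)
  let _ : Module R N := Module.compHom N (algebraMap R A)
  have : IsScalarTower R A M := ⟨fun r a m => by
    rw [Algebra.smul_def, mul_smul]; rfl⟩
  have : IsScalarTower R A N := ⟨fun r a m => by
    rw [Algebra.smul_def, mul_smul]; rfl⟩
  have : SMulCommClass A R M := IsScalarTower.to_smulCommClass'
  have : SMulCommClass A R N := IsScalarTower.to_smulCommClass'
  have : Module.Finite R N := Module.Finite.trans A N
  obtain ⟨k, s, hs⟩ := Module.Finite.exists_fin (R := A) (M := M)
  let ev : (M →ₗ[A] N) →ₗ[R] (Fin k → N) :=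
    { toFun := fun f i => f (s i), map_add' := fun _ _ => rfl, map_smul' := fun _ _ => rfl }
  have hev : Function.Injective ev := fun f g hfg =>
    LinearMap.ext_on_range hs fun i => congrFun hfg i
  have : Module.Finite R (M →ₗ[A] N) := Module.Finite.of_injective ev hev
  obtain ⟨n, h, hh⟩ := Module.Finite.exists_fin (R := R) (M := M →ₗ[A] N)
  refine ⟨n, h, fun f => ?_⟩
  obtain ⟨c, rfl⟩ := (Submodule.mem_span_range_iff_exists_fun R).1 (hh ▸ Submodule.mem_top : f ∈ _)
  -- Generators over `R` suffice on both sides, since scalars of `R` act through endomorphisms of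
  -- either module.
  refine ⟨⟨fun i => c i • LinearMap.id, ?_⟩, ⟨fun i => c i • LinearMap.id, ?_⟩⟩
  · simp [LinearMap.smul_comp]
  · refine Finset.sum_congr rfl fun i _ => LinearMap.ext fun x => ?_
    simp only [LinearMap.smul_apply, LinearMap.comp_apply, LinearMap.id_apply]
    exact (LinearMap.map_smul_of_tower (h i) (c i) x).symm

end Finiteness

/-! ### Indecomposable decompositions and projective-injective modules -/

section Decomposition

variable {A : Type u} [Ring A] {M N : Type u} [AddCommGroup M] [Module A M]
  [AddCommGroup N] [Module A N]

theorem injective_of_retract [Module.Injective A N] (i : M →ₗ[A] N) (p : N →ₗ[A] M)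
    (h : p ∘ₗ i = LinearMap.id) : Module.Injective A M where
  out X Y _ _ _ _ f hf g := by
    obtain ⟨k, hk⟩ := Module.Injective.out f hf (i ∘ₗ g)
    exact ⟨p ∘ₗ k, fun x => by
      rw [LinearMap.comp_apply, hk]; exact LinearMap.congr_fun h (g x)⟩

theorem injective_of_equiv [Module.Injective A N] (e : M ≃ₗ[A] N) : Module.Injective A M :=
  injective_of_retract e.toLinearMap e.symm.toLinearMap (by ext; simp)

theorem surjective_of_comp_eq_id {i : M →ₗ[A] N} {p : N →ₗ[A] M}
    (h : p ∘ₗ i = LinearMap.id) : Function.Surjective p :=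
  fun x => ⟨i x, LinearMap.congr_fun h x⟩

theorem injective_of_comp_eq_id {i : M →ₗ[A] N} {p : N →ₗ[A] M}
    (h : p ∘ₗ i = LinearMap.id) : Function.Injective i :=
  Function.LeftInverse.injective (g := p) fun x => LinearMap.congr_fun h x

/-- A surjection onto a nonzero projective module with indecomposable source is injective. -/
theorem Indecomposable.injective_of_surjective (h : Indecomposable A M) [Nontrivial N]
    [Module.Projective A N] (f : M →ₗ[A] N) (hf : Function.Surjective f) :
    Function.Injective f := by
  obtain ⟨s, hs⟩ := Module.projective_lifting_property f LinearMap.id hf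
  have hs' : ∀ x, f (s x) = x := LinearMap.congr_fun hs
  have hc : IsCompl (LinearMap.ker f) (LinearMap.range s) := by
    refine isCompl_iff.2 ⟨Submodule.disjoint_def.2 ?_, codisjoint_iff.2 (eq_top_iff.2 ?_)⟩
    · rintro _ hx ⟨y, rfl⟩
      rw [LinearMap.mem_ker, hs'] at hx
      rw [hx, map_zero]
    · exact fun x _ => Submodule.mem_sup.2
        ⟨x - s (f x), by simp [hs'], s (f x), ⟨_, rfl⟩, by simp⟩
  rcases h.2 _ _ hc with h | h
  · exact LinearMap.ker_eq_bot.1 h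
  · obtain ⟨x, hx⟩ := exists_ne (0 : N)
    refine absurd ?_ hx
    rw [← hs' x, LinearMap.range_eq_bot.1 h]
    simp

/-- Well-founded induction on submodules of `M`: a decomposable one splits into two strictly smaller
ones. -/
theorem exists_indecomposable_decomposition_submodule [IsArtinian A M] (N : Submodule A M) :
    ∃ (ι : Type) (_ : Finite ι) (X : ι → ModuleCat.{u} A),
      (∀ i, Indecomposable A (X i)) ∧ Nonempty (N ≃ₗ[A] (∀ i, X i)) := by
  induction N using IsWellFounded.induction (α := Submodule A M) (· < ·) with
  | ind N ih =>
    by_cases h0 : Subsingleton N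
    · exact ⟨Empty, inferInstance, fun i => i.elim, fun i => i.elim,
        ⟨0, 0, fun _ => Subsingleton.elim _ _, fun _ => Subsingleton.elim _ _⟩⟩
    by_cases hN : Indecomposable A N
    · exact ⟨Unit, inferInstance, fun _ => ModuleCat.of A N, fun _ => hN,
        ⟨(LinearEquiv.funUnique Unit A N).symm⟩⟩
    rw [not_subsingleton_iff_nontrivial] at h0
    have : ∃ N₁ N₂ : Submodule A N, IsCompl N₁ N₂ ∧ N₁ ≠ ⊥ ∧ N₂ ≠ ⊥ := by
      by_contra! hcon
      exact hN ⟨h0, fun N₁ N₂ h => or_iff_not_imp_left.2 (hcon N₁ N₂ h)⟩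
    obtain ⟨N₁, N₂, hc, h₁, h₂⟩ := this
    have key : ∀ K L : Submodule A N, IsCompl K L → L ≠ ⊥ → K.map N.subtype < N := by
      intro K L hKL hL
      refine lt_of_le_of_ne (Submodule.map_subtype_le _ _) fun h => hL ?_
      have : K = ⊤ := Submodule.map_injective_of_injective N.injective_subtype (by simpa using h)
      subst this
      simpa using hKL.inf_eq_bot
    obtain ⟨ι₁, _, X₁, hX₁, ⟨e₁⟩⟩ := ih _ (key _ _ hc h₂)
    obtain ⟨ι₂, _, X₂, hX₂, ⟨e₂⟩⟩ := ih _ (key _ _ hc.symm h₁)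
    refine ⟨ι₁ ⊕ ι₂, inferInstance, Sum.elim X₁ X₂, ?_, ⟨?_⟩⟩
    · rintro (i | i)
      exacts [hX₁ i, hX₂ i]
    · exact (Submodule.prodEquivOfIsCompl _ _ hc).symm ≪≫ₗ
        (LinearEquiv.prodCongr
          ((N₁.equivMapOfInjective _ N.injective_subtype).trans e₁)
          ((N₂.equivMapOfInjective _ N.injective_subtype).trans e₂)) ≪≫ₗ
        (LinearEquiv.sumPiEquivProdPi A ι₁ ι₂ fun i => (Sum.elim X₁ X₂ i : ModuleCat.{u} A)).symm

theorem exists_indecomposable_decomposition (M : Type u) [AddCommGroup M] [Module A M]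
    [IsArtinian A M] :
    ∃ (ι : Type) (_ : Finite ι) (X : ι → ModuleCat.{u} A),
      (∀ i, Indecomposable A (X i)) ∧ Nonempty (M ≃ₗ[A] (∀ i, X i)) := by
  obtain ⟨ι, hι, X, hX, ⟨e⟩⟩ := exists_indecomposable_decomposition_submodule (⊤ : Submodule A M)
  exact ⟨ι, hι, X, hX, ⟨Submodule.topEquiv.symm ≪≫ₗ e⟩⟩

/-- A finite family of modules contains representatives of its isomorphism classes. -/
theorem exists_representatives {ι : Type} [Finite ι] (X : ι → ModuleCat.{u} A) :
    ∃ (k : ℕ) (c : Fin k → ι), (∀ i j, Nonempty (X (c i) ≃ₗ[A] X (c j)) → i = j) ∧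
      ∀ i, ∃ j, Nonempty (X i ≃ₗ[A] X (c j)) := by
  let s : Setoid ι :=
    { r := fun i j => Nonempty (X i ≃ₗ[A] X j)
      iseqv := ⟨fun i => ⟨LinearEquiv.refl A _⟩, fun ⟨e⟩ => ⟨e.symm⟩,
        fun ⟨e⟩ ⟨e'⟩ => ⟨e.trans e'⟩⟩ }
  obtain ⟨k, ⟨e⟩⟩ := Finite.exists_equiv_fin (Quotient s)
  refine ⟨k, fun j => (e.symm j).out, fun i j h => ?_, fun i => ⟨e ⟦i⟧, ?_⟩⟩
  · exact e.symm.injective (Quotient.out_equiv_out.1 h)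
  · have h : s.r i (Quotient.out (⟦i⟧ : Quotient s)) := s.symm (Quotient.mk_out i)
    show Nonempty (X i ≃ₗ[A] X (e.symm (e ⟦i⟧)).out)
    rw [e.symm_apply_apply]
    exact h

theorem inAdd_pi_component {ι : Type} [Finite ι] (X : ι → ModuleCat.{u} A) (i : ι) :
    InAdd A (∀ i, X i) (X i) := by
  classical
  exact inAdd_of_retract (LinearMap.single A (fun i => X i) i) (LinearMap.proj i) (by ext; simp)

theorem finite_of_retract [Module.Finite A N] (i : M →ₗ[A] N) (p : N →ₗ[A] M)
    (h : p ∘ₗ i = LinearMap.id) : Module.Finite A M :=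
  Module.Finite.of_surjective p (surjective_of_comp_eq_id h)

/-- Every module of finite length has the same additive closure as a basic module, which can be
chosen to be a direct summand. -/
theorem exists_isBasic_retract (M : Type u) [AddCommGroup M] [Module A M] [IsArtinian A M] :
    ∃ T : ModuleCat.{u} A, IsBasic A T ∧ InAdd A T M ∧
      ∃ (i : T →ₗ[A] M) (p : M →ₗ[A] T), p ∘ₗ i = LinearMap.id := by
  classical
  obtain ⟨ι, _, X, hX, ⟨e⟩⟩ := exists_indecomposable_decomposition (A := A) M
  obtain ⟨k, c, hc, hc'⟩ := exists_representatives X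
  have hinj : Function.Injective c := fun i j h => hc i j (h ▸ ⟨LinearEquiv.refl A _⟩)
  refine ⟨ModuleCat.of A (∀ j, X (c j)), ⟨k, fun j => X (c j), fun j => hX _, hc,
    ⟨LinearEquiv.refl A _⟩⟩, ?_, ?_⟩
  · refine InAdd.trans (inAdd_pi (F := fun i => X i) fun i => ?_) (inAdd_of_equiv e)
    obtain ⟨j, ⟨e'⟩⟩ := hc' i
    exact (inAdd_pi_component (fun j => X (c j)) j).trans (inAdd_of_equiv e')
  · refine ⟨e.symm.toLinearMap ∘ₗ
        ∑ j, LinearMap.single A (fun i => X i) (c j) ∘ₗ LinearMap.proj j,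
      LinearMap.pi (fun j => LinearMap.proj (c j)) ∘ₗ e.toLinearMap, ?_⟩
    refine LinearMap.ext fun x => funext fun j => ?_
    simp only [LinearMap.comp_apply, LinearEquiv.coe_coe, LinearEquiv.apply_symm_apply,
      LinearMap.pi_apply, LinearMap.proj_apply, LinearMap.id_apply, LinearMap.coe_sum,
      Finset.sum_apply]
    rw [Finset.sum_eq_single j]
    · simp
    · intro i _ hij
      exact Pi.single_eq_of_ne (fun h => hij (hinj h).symm) _
    · simp

/-- A finitely generated indecomposable projective module over an artinian ring is isomorphic to
one of the indecomposable summands of the ring. -/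
theorem Indecomposable.exists_equiv_of_projective [IsArtinianRing A] [Module.Finite A M]
    [Module.Projective A M] (hM : Indecomposable A M) {ι : Type} [Finite ι]
    (P : ι → ModuleCat.{u} A) (hP : ∀ i, Indecomposable A (P i)) (e : A ≃ₗ[A] (∀ i, P i)) :
    ∃ i, Nonempty (M ≃ₗ[A] P i) := by
  classical
  have := hM.1
  have hproj : ∀ i, Module.Projective A (P i) := fun i =>
    Module.Projective.of_split (e.symm.toLinearMap ∘ₗ LinearMap.single A (fun i => P i) i)
      (LinearMap.proj i ∘ₗ e.toLinearMap) (by ext; simp)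
  obtain ⟨N, hN⟩ := IsCoatomic.exists_coatom (Submodule A M)
  have hS : IsSimpleModule A (M ⧸ N) := isSimpleModule_iff_isCoatom.2 hN
  obtain ⟨x, hx⟩ := SetLike.exists_not_mem_of_ne_top N hN.1 rfl
  have hx0 : N.mkQ x ≠ 0 := by simpa using hx
  let q : (∀ i, P i) →ₗ[A] M ⧸ N := LinearMap.toSpanSingleton A _ (N.mkQ x) ∘ₗ e.symm.toLinearMap
  have hq : q ≠ 0 := fun h => hx0 (by simpa [q] using LinearMap.congr_fun h (e 1))
  obtain ⟨i, hi⟩ : ∃ i, q ∘ₗ LinearMap.single A (fun i => P i) i ≠ 0 := by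
    by_contra! h
    exact hq (LinearMap.pi_ext' fun i => by simpa using h i)
  obtain ⟨a, ha⟩ := Module.projective_lifting_property N.mkQ
    (q ∘ₗ LinearMap.single A (fun i => P i) i) N.mkQ_surjective
  obtain ⟨b, hb⟩ := Module.projective_lifting_property
    (q ∘ₗ LinearMap.single A (fun i => P i) i) N.mkQ (LinearMap.surjective_of_ne_zero hi)
  -- `a` and `b` are lifts, between `P i` and `M`, of maps onto the same simple quotient `M ⧸ N`, so
  -- `a ∘ₗ b` is the identity modulo `N` and is not nilpotent.
  have hab : ∀ n : ℕ, N.mkQ ∘ₗ (a ∘ₗ b) ^ n = N.mkQ := by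
    intro n
    induction n with
    | zero => rfl
    | succ n ih =>
      rw [pow_succ, Module.End.mul_eq_comp, ← LinearMap.comp_assoc, ih, ← LinearMap.comp_assoc,
        ha, hb]
  have : IsArtinian A M := inferInstance
  -- Fitting's lemma: on the indecomposable `M` a non-nilpotent endomorphism is bijective. The
  -- exponent must be at least 1 so that `a` can be read off as a left factor.
  obtain ⟨n, hn, hn'⟩ :=
    ((LinearMap.eventually_isCompl_ker_pow_range_pow (a ∘ₗ b)).and
      (Filter.eventually_ge_atTop 1)).exists
  have hinj : Function.Injective ((a ∘ₗ b) ^ n) := by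
    rcases hM.2 _ _ hn with h | h
    · exact LinearMap.ker_eq_bot.1 h
    · refine absurd (hab n) ?_
      rw [LinearMap.range_eq_bot.1 h, LinearMap.comp_zero]
      exact fun h => hx0 (LinearMap.congr_fun h x).symm
  have hsurj : Function.Surjective ((a ∘ₗ b) ^ n) :=
    IsArtinian.surjective_of_injective_endomorphism _ hinj
  have hasurj : Function.Surjective a := by
    obtain ⟨k, rfl⟩ := Nat.exists_eq_add_of_le' hn'
    intro y
    obtain ⟨z, hz⟩ := hsurj y
    rw [pow_succ'] at hz
    exact ⟨_, hz⟩
  exact ⟨i, ⟨(LinearEquiv.ofBijective a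
    ⟨(hP i).injective_of_surjective a hasurj, hasurj⟩).symm⟩⟩

variable (A) in
/-- Finitely generated projective-injective modules. -/
structure IsFinProjInj (M : Type u) [AddCommGroup M] [Module A M] : Prop where
  finite : Module.Finite A M
  projective : Module.Projective A M
  injective : Module.Injective A M

theorem IsFinProjInj.of_retract (h : IsFinProjInj A N) (i : M →ₗ[A] N) (p : N →ₗ[A] M)
    (hp : p ∘ₗ i = LinearMap.id) : IsFinProjInj A M where
  finite := have := h.finite; finite_of_retract i p hp
  projective := have := h.projective; Module.Projective.of_split i p hp
  injective := have := h.injective; injective_of_retract i p hp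

theorem IsFinProjInj.prod (h : IsFinProjInj A M) (h' : IsFinProjInj A N) :
    IsFinProjInj A (M × N) where
  finite := have := h.finite; have := h'.finite; inferInstance
  projective := have := h.projective; have := h'.projective; inferInstance
  injective := by
    have := h.injective
    have := h'.injective
    refine ⟨fun X Y _ _ _ _ f hf g => ?_⟩
    obtain ⟨k, hk⟩ := Module.Injective.out f hf (LinearMap.fst A M N ∘ₗ g)
    obtain ⟨l, hl⟩ := Module.Injective.out f hf (LinearMap.snd A M N ∘ₗ g)
    exact ⟨k.prod l, fun x => Prod.ext (hk x) (hl x)⟩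

theorem projective_pi {ι : Type} [Finite ι] {F : ι → Type u} [∀ i, AddCommGroup (F i)]
    [∀ i, Module A (F i)] [∀ i, Module.Projective A (F i)] : Module.Projective A (∀ i, F i) := by
  classical
  have := Fintype.ofFinite ι
  exact Module.Projective.of_equiv (DirectSum.linearEquivFunOnFintype A ι F)

theorem IsFinProjInj.pi {ι : Type} [Finite ι] {F : ι → Type u} [∀ i, AddCommGroup (F i)]
    [∀ i, Module A (F i)] (h : ∀ i, IsFinProjInj A (F i)) : IsFinProjInj A (∀ i, F i) where
  finite := have := fun i => (h i).finite; inferInstance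
  projective := have := fun i => (h i).projective; projective_pi
  injective := have := fun i => (h i).injective; Module.Injective.pi A F

theorem IsProjInjReps.isFinProjInj {t : ℕ} {Q : Fin t → ModuleCat.{u} A}
    (h : IsProjInjReps A Q) : IsFinProjInj A (∀ i, Q i) :=
  IsFinProjInj.pi fun i => ⟨h.finite i, h.projective i, h.injective i⟩

theorem IsProjInjReps.inAdd [IsArtinianRing A] {t : ℕ} {Q : Fin t → ModuleCat.{u} A}
    (h : IsProjInjReps A Q) (hM : IsFinProjInj A M) : InAdd A (∀ i, Q i) M := by
  classical
  have := hM.finite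
  have : IsArtinian A M := inferInstance
  obtain ⟨ι, _, X, hX, ⟨e⟩⟩ := exists_indecomposable_decomposition (A := A) M
  refine InAdd.trans (inAdd_pi (F := fun i => X i) fun i => ?_) (inAdd_of_equiv e)
  have hXi : IsFinProjInj A (X i) := hM.of_retract
    (e.symm.toLinearMap ∘ₗ LinearMap.single A (fun i => X i) i)
    (LinearMap.proj i ∘ₗ e.toLinearMap) (by ext; simp)
  obtain ⟨j, ⟨e'⟩⟩ := h.exists_iso (X i) hXi.finite (hX i) hXi.projective hXi.injective
  exact (inAdd_pi_component Q j).trans (inAdd_of_equiv e')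

variable (A) in
-- Finitely many representatives suffice because each finitely generated indecomposable projective
-- is a summand of the ring; the injective ones among these summands are kept, up to isomorphism.
theorem exists_isProjInjReps [IsArtinianRing A] :
    ∃ (t : ℕ) (Q : Fin t → ModuleCat.{u} A), IsProjInjReps A Q := by
  classical
  obtain ⟨ι, _, P, hP, ⟨e⟩⟩ := exists_indecomposable_decomposition (A := A) A
  have hret : ∀ i, (LinearMap.proj i ∘ₗ e.toLinearMap) ∘ₗ
      (e.symm.toLinearMap ∘ₗ LinearMap.single A (fun i => P i) i) = LinearMap.id :=
    fun i => by ext; simp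
  obtain ⟨k, c, hc, hc'⟩ :=
    exists_representatives fun i : {i : ι // Module.Injective A (P i)} => P i
  refine ⟨k, fun j => P (c j), fun j => finite_of_retract _ _ (hret _), fun j => hP _,
    fun j => Module.Projective.of_split _ _ (hret _), fun j => (c j).2, hc, ?_⟩
  intro M _ hM _ hMi
  obtain ⟨i, ⟨e'⟩⟩ := hM.exists_equiv_of_projective P hP e
  obtain ⟨j, ⟨e''⟩⟩ := hc' ⟨i, injective_of_equiv e'.symm⟩
  exact ⟨j, ⟨e'.trans e''⟩⟩

end Decomposition

/-! ### Injective envelopes -/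

section Envelopes

variable {A : Type u} [Ring A] {M E Q : Type u} [AddCommGroup M] [Module A M]
  [AddCommGroup E] [Module A E] [AddCommGroup Q] [Module A Q]

variable (A) in
theorem exists_injective_embedding (M : Type u) [AddCommGroup M] [Module A M] :
    ∃ (E : ModuleCat.{u} A) (f : M →ₗ[A] E), Module.Injective A E ∧ Function.Injective f :=
  let X : ModuleCat.{u} A := ModuleCat.of A M
  let I : ModuleCat.{u} A := Injective.under X
  ⟨I, (Injective.ι X).hom,
    Module.injective_module_of_injective_object A I
      (inj := (inferInstance : Injective (Injective.under X))),
    (ModuleCat.mono_iff_injective (Injective.ι X)).1 inferInstance⟩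

theorem exists_maximal_disjoint (N : Submodule A E) :
    ∃ K : Submodule A E, N ⊓ K = ⊥ ∧ ∀ L, K ≤ L → N ⊓ L = ⊥ → L = K := by
  obtain ⟨K, hK⟩ := zorn_le₀ {K : Submodule A E | N ⊓ K = ⊥} (by
    intro c hc hchain
    refine ⟨sSup c, ?_, fun K hK => le_sSup hK⟩
    rw [Set.mem_ofPred_eq, hchain.directedOn.inf_sSup_eq, eq_bot_iff]
    exact iSup₂_le fun K hK => (hc hK).le)
  exact ⟨K, hK.prop, fun L hL h => (hK.eq_of_le h hL).symm⟩

/-- A maximal essential extension inside an injective module. -/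
theorem exists_maximal_essential (N₀ : Submodule A E) :
    ∃ N : Submodule A E, N₀ ≤ N ∧ (∀ K ≤ N, N₀ ⊓ K = ⊥ → K = ⊥) ∧
      ∀ L, N ≤ L → (∀ K ≤ L, N₀ ⊓ K = ⊥ → K = ⊥) → L = N := by
  obtain ⟨N, h₀, hN⟩ := zorn_le_nonempty₀
    {N : Submodule A E | N₀ ≤ N ∧ ∀ K ≤ N, N₀ ⊓ K = ⊥ → K = ⊥} (by
      intro c hc hchain y hy
      refine ⟨sSup c, ⟨(hc hy).1.trans (le_sSup hy), fun K hK h => ?_⟩, fun K hK => le_sSup hK⟩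
      rw [Submodule.eq_bot_iff]
      intro x hx
      obtain ⟨N, hN, hxN⟩ := (Submodule.mem_sSup_of_directed ⟨y, hy⟩ hchain.directedOn).1 (hK hx)
      have hxK : Submodule.span A {x} ≤ K := by simpa using hx
      have := (hc hN).2 (Submodule.span A {x}) (by simpa using hxN)
        (eq_bot_iff.2 ((inf_le_inf_left _ hxK).trans h.le))
      simpa using this) N₀ ⟨le_rfl, fun K hK h => by rwa [inf_eq_right.2 hK] at h⟩
  exact ⟨N, hN.prop.1, hN.prop.2, fun L hL h =>
    (hN.eq_of_le ⟨hN.prop.1.trans hL, h⟩ hL).symm⟩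

theorem injective_of_isEssential {N : Submodule A E} (hN : IsEssential A N) (h : E →ₗ[A] Q)
    (hh : ∀ x ∈ N, h x = 0 → x = 0) : Function.Injective h := by
  refine LinearMap.ker_eq_bot.1 (hN _ ?_)
  rw [Submodule.eq_bot_iff]
  exact fun x hx => hh x hx.1 hx.2

variable (A) in
-- Inside an injective `E` containing `M`, take a maximal essential extension `N` of `M` and a
-- maximal `K` with `N ⊓ K = ⊥`. Then `N → E ⧸ K` is essential, so the inclusion of `N` extends to
-- an embedding of `E ⧸ K` in `E`. Its image is essential over `M`, hence equals `N` by maximality,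
-- and `N` is a retract of `E`.
theorem exists_isInjectiveEnvelope (M : Type u) [AddCommGroup M] [Module A M] :
    ∃ (E : ModuleCat.{u} A) (f : M →ₗ[A] E), IsInjectiveEnvelope A f := by
  obtain ⟨E, ι, hE, hι⟩ := exists_injective_embedding A M
  obtain ⟨N, hN₀, hN, hmax⟩ := exists_maximal_essential (LinearMap.range ι)
  obtain ⟨K, hK, hKmax⟩ := exists_maximal_disjoint N
  have hj : Function.Injective (K.mkQ ∘ₗ N.subtype) := by
    rw [← LinearMap.ker_eq_bot, Submodule.eq_bot_iff]
    rintro ⟨x, hx⟩ h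
    have : x ∈ N ⊓ K := ⟨hx, by simpa using h⟩
    rw [hK] at this
    simpa using this
  have hess : IsEssential A (LinearMap.range (K.mkQ ∘ₗ N.subtype)) := by
    intro L hL
    have : L.comap K.mkQ = K := hKmax _ (by
        intro x hx
        have : K.mkQ x = 0 := (Submodule.Quotient.mk_eq_zero K).2 hx
        rw [Submodule.mem_comap, this]
        exact L.zero_mem) (by
      rw [Submodule.eq_bot_iff]
      rintro x ⟨hx, hxL⟩
      have : K.mkQ x ∈ LinearMap.range (K.mkQ ∘ₗ N.subtype) ⊓ L := ⟨⟨⟨x, hx⟩, rfl⟩, hxL⟩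
      rw [hL, Submodule.mem_bot] at this
      have : x ∈ N ⊓ K := ⟨hx, by simpa using this⟩
      rwa [hK] at this)
    rw [← Submodule.map_comap_eq_of_surjective K.mkQ_surjective L, this, Submodule.mkQ_map_self]
  obtain ⟨h, hh⟩ := Module.Injective.out (Q := E) (K.mkQ ∘ₗ N.subtype) hj N.subtype
  have hinj : Function.Injective h := injective_of_isEssential hess h (by
    rintro _ ⟨x, rfl⟩ hx
    rw [hh] at hx
    simp at hx
    simp [hx])
  have hrange : LinearMap.range h = N := by
    refine hmax _ (fun x hx => ⟨_, hh ⟨x, hx⟩⟩) fun L hL hL0 => ?_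
    have h1 : N ⊓ L = ⊥ := hN _ inf_le_left (eq_bot_iff.2
      ((inf_le_inf_left _ inf_le_right).trans hL0.le))
    have h2 : L.comap h = ⊥ := hess _ (by
      rw [Submodule.eq_bot_iff]
      rintro _ ⟨⟨x, rfl⟩, hx⟩
      have hx : h ((K.mkQ ∘ₗ N.subtype) x) ∈ L := hx
      rw [hh] at hx
      have : (x : E) ∈ N ⊓ L := ⟨x.2, hx⟩
      rw [h1, Submodule.mem_bot] at this
      simp [this])
    rw [← Submodule.map_comap_eq_of_le hL, h2, Submodule.map_bot]
  refine ⟨ModuleCat.of A N, ι.codRestrict N fun x => hN₀ ⟨x, rfl⟩, ?_, ?_, ?_⟩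
  · refine injective_of_retract (N := E) N.subtype
      ((h ∘ₗ K.mkQ).codRestrict N fun x => hrange ▸ ⟨_, rfl⟩) ?_
    ext x
    simpa using hh x
  · exact fun x y hxy => hι (congrArg Subtype.val hxy)
  · intro L hL
    have := hN (L.map N.subtype) (Submodule.map_subtype_le _ _) (by
      rw [Submodule.eq_bot_iff]
      rintro _ ⟨⟨y, rfl⟩, ⟨z, hz, hzy⟩⟩
      have : z ∈ LinearMap.range (ι.codRestrict N fun x => hN₀ ⟨x, rfl⟩) ⊓ L :=
        ⟨⟨y, Subtype.ext hzy.symm⟩, hz⟩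
      rw [hL, Submodule.mem_bot] at this
      rw [← hzy, this, map_zero])
    exact Submodule.map_injective_of_injective N.injective_subtype (by simpa using this)

/-- An injective envelope of `M` is a direct summand of every injective module containing `M`. -/
theorem IsInjectiveEnvelope.exists_retract {f : M →ₗ[A] E} (hf : IsInjectiveEnvelope A f)
    [Module.Injective A Q] (g : M →ₗ[A] Q) (hg : Function.Injective g) :
    ∃ (i : E →ₗ[A] Q) (p : Q →ₗ[A] E), p ∘ₗ i = LinearMap.id ∧ i ∘ₗ f = g := by
  obtain ⟨i, hi⟩ := Module.Injective.out f hf.injective g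
  have hinj : Function.Injective i := injective_of_isEssential hf.essential i (by
    rintro _ ⟨x, rfl⟩ hx
    rw [hi, map_eq_zero_iff g hg] at hx
    rw [hx, map_zero])
  have := hf.injective_module
  obtain ⟨p, hp⟩ := Module.Injective.out i hinj (LinearMap.id : E →ₗ[A] E)
  exact ⟨i, p, LinearMap.ext hp, LinearMap.ext hi⟩

/-- A projective essential extension of a finitely generated module is finitely generated. -/
theorem finite_of_isEssential [IsNoetherianRing A] [Module.Projective A E] {N : Submodule A E}
    (hN : IsEssential A N) (hfg : N.FG) : Module.Finite A E := by
  classical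
  obtain ⟨s, hs⟩ := Module.Projective.out (R := A) (P := E)
  obtain ⟨G, rfl⟩ := hfg
  -- `F` collects the finitely many coordinates used by `N` under the splitting `s`. Projecting to
  -- them is injective on `N`, hence on `E` by essentiality, so `E` embeds in a finite free module.
  let F : Finset E := G.biUnion fun y => (s y).support
  have hF : Submodule.span A (G : Set E) ≤ (Finsupp.supported A A (F : Set E)).comap s := by
    rw [Submodule.span_le]
    intro y hy
    simp only [SetLike.mem_coe, Submodule.mem_comap, Finsupp.mem_supported]
    exact_mod_cast Finset.subset_biUnion_of_mem (fun y => (s y).support) hy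
  let ρ : E →ₗ[A] (F → A) := LinearMap.pi (fun e : F => Finsupp.lapply (e : E)) ∘ₗ s
  have hρ : Function.Injective ρ := injective_of_isEssential hN ρ (by
    intro x hx hx0
    have h0 : s x = 0 := by
      ext e
      by_cases he : e ∈ F
      · exact congrFun hx0 ⟨e, he⟩
      · by_contra hne
        exact he ((Finsupp.mem_supported A (s x)).1 (hF hx) (Finsupp.mem_support_iff.2 hne))
    rw [← hs x, h0, map_zero])
  exact Module.Finite.of_injective ρ hρ

end Envelopes

/-! ### Minimal injective resolutions and dominant dimension at least 2 -/

section Resolutions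

variable (A : Type u) [Ring A]

/-- A chosen injective envelope. -/
noncomputable def envelope (M : ModuleCat.{u} A) : ModuleCat.{u} A :=
  (exists_isInjectiveEnvelope A M).choose

/-- The inclusion of a module in its chosen injective envelope. -/
noncomputable def envelopeMap (M : ModuleCat.{u} A) : M →ₗ[A] envelope A M :=
  (exists_isInjectiveEnvelope A M).choose_spec.choose

theorem isInjectiveEnvelope_envelopeMap (M : ModuleCat.{u} A) :
    IsInjectiveEnvelope A (envelopeMap A M) :=
  (exists_isInjectiveEnvelope A M).choose_spec.choose_spec

/-- The iterated cosyzygies of a module. -/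
noncomputable def cosyzygy (M : ModuleCat.{u} A) : ℕ → ModuleCat.{u} A
  | 0 => M
  | n + 1 => ModuleCat.of A
      (envelope A (cosyzygy M n) ⧸ LinearMap.range (envelopeMap A (cosyzygy M n)))

/-- The projection of an injective envelope onto the next cosyzygy. -/
noncomputable def cosyzygyProj (M : ModuleCat.{u} A) (n : ℕ) :
    envelope A (cosyzygy A M n) →ₗ[A] cosyzygy A M (n + 1) :=
  Submodule.mkQ (LinearMap.range (envelopeMap A (cosyzygy A M n)))

theorem cosyzygyProj_surjective (M : ModuleCat.{u} A) (n : ℕ) :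
    Function.Surjective (cosyzygyProj A M n) :=
  Submodule.mkQ_surjective _

theorem exact_cosyzygyProj (M : ModuleCat.{u} A) (n : ℕ) :
    Function.Exact (envelopeMap A (cosyzygy A M n)) (cosyzygyProj A M n) :=
  LinearMap.exact_map_mkQ_range _

theorem range_envelopeMap_comp_cosyzygyProj (M : ModuleCat.{u} A) (n : ℕ) :
    LinearMap.range (envelopeMap A (cosyzygy A M (n + 1)) ∘ₗ cosyzygyProj A M n) =
      LinearMap.range (envelopeMap A (cosyzygy A M (n + 1))) :=
  LinearMap.range_comp_of_range_eq_top _ (LinearMap.range_eq_top.2 (cosyzygyProj_surjective A M n))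

theorem exact_envelopeMap_comp_cosyzygyProj (M : ModuleCat.{u} A) (n : ℕ) :
    Function.Exact (envelopeMap A (cosyzygy A M n))
      (envelopeMap A (cosyzygy A M (n + 1)) ∘ₗ cosyzygyProj A M n) := by
  intro x
  rw [LinearMap.comp_apply, map_eq_zero_iff _ (isInjectiveEnvelope_envelopeMap A _).injective]
  exact exact_cosyzygyProj A M n x

/-- The minimal injective resolution built from the chosen injective envelopes. -/
noncomputable def minimalInjectiveResolution (M : ModuleCat.{u} A) :
    MinimalInjectiveResolution A M where
  I n := envelope A (cosyzygy A M n)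
  ε := envelopeMap A M
  d n := envelopeMap A (cosyzygy A M (n + 1)) ∘ₗ cosyzygyProj A M n
  injective_module n := (isInjectiveEnvelope_envelopeMap A _).injective_module
  injective_ε := (isInjectiveEnvelope_envelopeMap A M).injective
  exact_zero := exact_envelopeMap_comp_cosyzygyProj A M 0
  exact_succ n := by
    have h := exact_envelopeMap_comp_cosyzygyProj A M (n + 1)
    rw [LinearMap.exact_iff] at h ⊢
    rw [h, range_envelopeMap_comp_cosyzygyProj]
  essential_ε := (isInjectiveEnvelope_envelopeMap A M).essential
  essential_d n := by
    rw [range_envelopeMap_comp_cosyzygyProj]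
    exact (isInjectiveEnvelope_envelopeMap A _).essential

/-- The ring has a copresentation by finitely generated projective-injective modules. -/
def HasProjInjCopresentation : Prop :=
  ∃ (Q₀ Q₁ : ModuleCat.{u} A) (f : A →ₗ[A] Q₀) (g : Q₀ →ₗ[A] Q₁), IsFinProjInj A Q₀ ∧
    IsFinProjInj A Q₁ ∧ Function.Injective f ∧ Function.Exact f g

/-- Projective terms of a minimal resolution are finitely generated, as essential extensions of
finitely generated modules. Conversely, the first two minimal terms are summands of the terms of any
injective copresentation. -/
theorem two_le_domDim_iff [IsNoetherianRing A] :
    2 ≤ domDim A ↔ HasProjInjCopresentation A := by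
  constructor
  · intro h
    obtain ⟨_, ⟨S, n, rfl, hS⟩, hn⟩ := lt_sSup_iff.1
      (lt_of_lt_of_le (by norm_num : (1 : ℕ∞) < 2) h)
    have hn : 1 < n := by exact_mod_cast hn
    have := hS 0 (by lia)
    have := hS 1 hn
    have h0 : Module.Finite A (S.I 0) :=
      finite_of_isEssential S.essential_ε (Module.Finite.iff_fg.1 inferInstance)
    have h1 : Module.Finite A (S.I 1) :=
      finite_of_isEssential (S.essential_d 0) (Module.Finite.iff_fg.1 inferInstance)
    exact ⟨S.I 0, S.I 1, S.ε, S.d 0, ⟨h0, hS 0 (by lia), S.injective_module 0⟩,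
      ⟨h1, hS 1 hn, S.injective_module 1⟩, S.injective_ε, S.exact_zero⟩
  · rintro ⟨Q₀, Q₁, f, g, hQ₀, hQ₁, hf, hfg⟩
    have := hQ₀.injective
    have := hQ₁.injective
    obtain ⟨i, p, hp, hi⟩ :=
      (isInjectiveEnvelope_envelopeMap A (ModuleCat.of A A)).exists_retract f hf
    have hle : LinearMap.range (envelopeMap A (ModuleCat.of A A)) ≤ LinearMap.ker (g ∘ₗ i) := by
      rintro _ ⟨x, rfl⟩
      have : i (envelopeMap A (ModuleCat.of A A) x) = f x := LinearMap.congr_fun hi x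
      rw [LinearMap.mem_ker, LinearMap.comp_apply, this]
      exact hfg.apply_apply_eq_zero x
    -- The first cosyzygy embeds in `Q₁`, so its envelope is a summand of `Q₁`.
    have hinj : Function.Injective (Submodule.liftQ _ (g ∘ₗ i) hle) := by
      rw [← LinearMap.ker_eq_bot, Submodule.ker_liftQ_eq_bot]
      intro x hx
      obtain ⟨a, ha⟩ := (hfg (i x)).1 hx
      refine ⟨a, injective_of_comp_eq_id hp ?_⟩
      rw [← ha]
      exact LinearMap.congr_fun hi a
    obtain ⟨j, q, hq, -⟩ := (isInjectiveEnvelope_envelopeMap A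
      (cosyzygy A (ModuleCat.of A A) 1)).exists_retract (Q := Q₁) _ hinj
    refine le_sSup ⟨minimalInjectiveResolution A (ModuleCat.of A A), 2, rfl, fun k hk => ?_⟩
    interval_cases k
    · exact (hQ₀.of_retract i p hp).projective
    · exact (hQ₁.of_retract j q hq).projective

end Resolutions

/-! ### Vanishing of Ext¹ as a lifting or extension property -/

section Extensions

variable {A : Type u} [Ring A]

variable (A) in
/-- The first extension group vanishes. -/
abbrev ExtZero (C M : Type u) [AddCommGroup C] [Module A C] [AddCommGroup M] [Module A M] : Prop :=
  Subsingleton (Abelian.Ext.{u} (ModuleCat.of A C) (ModuleCat.of A M) 1)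

variable {C M X Y Z T : Type u} [AddCommGroup C] [Module A C] [AddCommGroup M] [Module A M]
  [AddCommGroup X] [Module A X] [AddCommGroup Y] [Module A Y] [AddCommGroup Z] [Module A Z]
  [AddCommGroup T] [Module A T]

/-- The short complex attached to an exact pair of linear maps. -/
abbrev shortComplexOfExact (i : X →ₗ[A] Y) (p : Y →ₗ[A] Z) (h : Function.Exact i p) :
    ShortComplex (ModuleCat.{u} A) :=
  ModuleCat.shortComplexOfCompEqZero i p h.linearMap_comp_eq_zero

theorem shortExact_shortComplexOfExact {i : X →ₗ[A] Y} {p : Y →ₗ[A] Z} (hi : Function.Injective i)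
    (h : Function.Exact i p) (hp : Function.Surjective p) :
    (shortComplexOfExact i p h).ShortExact :=
  ModuleCat.shortComplex_shortExact _ h hi hp

theorem ExtZero.exists_lift (hext : ExtZero A C X) {i : X →ₗ[A] Y} {p : Y →ₗ[A] Z}
    (hi : Function.Injective i) (h : Function.Exact i p) (hp : Function.Surjective p)
    (f : C →ₗ[A] Z) : ∃ g : C →ₗ[A] Y, p ∘ₗ g = f := by
  obtain ⟨x, hx⟩ := Abelian.Ext.covariant_sequence_exact₃ (ModuleCat.of A C)
    (shortExact_shortComplexOfExact hi h hp)
    (Abelian.Ext.mk₀ (ModuleCat.ofHom f)) (zero_add 1) (Subsingleton.elim (h := hext) _ _)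
  obtain ⟨g, rfl⟩ := (Abelian.Ext.mk₀_bijective _ _).2 x
  rw [Abelian.Ext.mk₀_comp_mk₀] at hx
  have := (Abelian.Ext.mk₀_bijective _ _).1 hx
  exact ⟨g.hom, congrArg ModuleCat.Hom.hom this⟩

/-- Since Ext¹ into the injective `Y` vanishes, every class comes from some `f : C →ₗ[A] Z` by the
connecting map, which kills maps that lift to `Y`. One injective embedding of `X` thus suffices for
the test. -/
theorem extZero_of_exists_lift [Module.Injective A Y] {i : X →ₗ[A] Y} {p : Y →ₗ[A] Z}
    (hi : Function.Injective i) (h : Function.Exact i p) (hp : Function.Surjective p)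
    (hlift : ∀ f : C →ₗ[A] Z, ∃ g : C →ₗ[A] Y, p ∘ₗ g = f) : ExtZero A C X := by
  have hS := shortExact_shortComplexOfExact hi h hp
  have : Injective (ModuleCat.of A Y) := Module.injective_object_of_injective_module A Y
  refine subsingleton_of_forall_eq 0 fun e => ?_
  obtain ⟨x, rfl⟩ := Abelian.Ext.covariant_sequence_exact₁ (ModuleCat.of A C) hS e
    (Abelian.Ext.eq_zero_of_injective (I := ModuleCat.of A Y) _) (zero_add 1)
  obtain ⟨f, rfl⟩ := (Abelian.Ext.mk₀_bijective _ _).2 x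
  obtain ⟨g, hg⟩ := hlift f.hom
  have : f = ModuleCat.ofHom g ≫ (shortComplexOfExact i p h).g := by
    rw [← ModuleCat.hom_ext_iff.2 hg]; rfl
  rw [this, ← Abelian.Ext.mk₀_comp_mk₀, Abelian.Ext.comp_assoc_of_second_deg_zero,
    ShortComplex.ShortExact.comp_extClass, Abelian.Ext.comp_zero]

theorem ExtZero.exists_extension (hext : ExtZero A Z M) {i : X →ₗ[A] Y} {p : Y →ₗ[A] Z}
    (hi : Function.Injective i) (h : Function.Exact i p) (hp : Function.Surjective p)
    (f : X →ₗ[A] M) : ∃ g : Y →ₗ[A] M, g ∘ₗ i = f := by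
  obtain ⟨x, hx⟩ := Abelian.Ext.contravariant_sequence_exact₁
    (shortExact_shortComplexOfExact hi h hp) (ModuleCat.of A M)
    (Abelian.Ext.mk₀ (ModuleCat.ofHom f)) (add_zero 1) (Subsingleton.elim (h := hext) _ _)
  obtain ⟨g, rfl⟩ := (Abelian.Ext.mk₀_bijective _ _).2 x
  rw [Abelian.Ext.mk₀_comp_mk₀] at hx
  have := (Abelian.Ext.mk₀_bijective _ _).1 hx
  exact ⟨g.hom, congrArg ModuleCat.Hom.hom this⟩

theorem extZero_of_exists_extension [Module.Projective A Y] {i : X →ₗ[A] Y} {p : Y →ₗ[A] Z}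
    (hi : Function.Injective i) (h : Function.Exact i p) (hp : Function.Surjective p)
    (hextend : ∀ f : X →ₗ[A] M, ∃ g : Y →ₗ[A] M, g ∘ₗ i = f) : ExtZero A Z M := by
  have hS := shortExact_shortComplexOfExact hi h hp
  have : Projective (ModuleCat.of A Y) := ModuleCat.projective_of_categoryTheory_projective _
  refine subsingleton_of_forall_eq 0 fun e => ?_
  obtain ⟨x, rfl⟩ := Abelian.Ext.contravariant_sequence_exact₃ hS (ModuleCat.of A M) e
    (Abelian.Ext.eq_zero_of_projective (P := ModuleCat.of A Y) _) (add_zero 1)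
  obtain ⟨f, rfl⟩ := (Abelian.Ext.mk₀_bijective _ _).2 x
  obtain ⟨g, hg⟩ := hextend f.hom
  have : f = (shortComplexOfExact i p h).f ≫ ModuleCat.ofHom g := by
    rw [← ModuleCat.hom_ext_iff.2 hg]; rfl
  rw [this, ← Abelian.Ext.mk₀_comp_mk₀, ← Abelian.Ext.comp_assoc_of_second_deg_zero,
    ShortComplex.ShortExact.extClass_comp, Abelian.Ext.zero_comp]

theorem ExtZero.of_inAdd_left (h : ExtZero A T M) (hC : InAdd A T C) : ExtZero A C M := by
  obtain ⟨E, ι, _, hι⟩ := exists_injective_embedding A M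
  have hex := LinearMap.exact_map_mkQ_range ι
  refine extZero_of_exists_lift hι hex (Submodule.mkQ_surjective _) fun f => ?_
  obtain ⟨m, i, q, hq⟩ := hC
  classical
  choose g hg using fun j => h.exists_lift hι hex (Submodule.mkQ_surjective _)
    (f ∘ₗ q ∘ₗ LinearMap.single A (fun _ : Fin m => T) j)
  refine ⟨coprodMap g ∘ₗ i, ?_⟩
  have : (LinearMap.range ι).mkQ ∘ₗ coprodMap g = f ∘ₗ q := by
    refine LinearMap.pi_ext' fun j => ?_
    rw [LinearMap.comp_assoc, coprodMap_comp_single, hg j, LinearMap.comp_assoc]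
  rw [← LinearMap.comp_assoc, this, LinearMap.comp_assoc, hq, LinearMap.comp_id]

theorem exists_projective_surjection (A : Type u) [Ring A] (M : Type u) [AddCommGroup M]
    [Module A M] : ∃ (P : ModuleCat.{u} A) (p : P →ₗ[A] M), Module.Projective A P ∧
      Function.Surjective p :=
  ⟨ModuleCat.of A (M →₀ A), Finsupp.linearCombination A id, inferInstance,
    Finsupp.linearCombination_id_surjective A M⟩

theorem ExtZero.of_inAdd_right (h : ExtZero A C T) (hM : InAdd A T M) : ExtZero A C M := by
  obtain ⟨P, p, _, hp⟩ := exists_projective_surjection A C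
  have hex : Function.Exact (LinearMap.ker p).subtype p := LinearMap.exact_subtype_ker_map p
  refine extZero_of_exists_extension (Submodule.injective_subtype _) hex hp fun f => ?_
  obtain ⟨m, i, q, hq⟩ := hM
  choose g hg using fun j => h.exists_extension (Submodule.injective_subtype _) hex hp
    (LinearMap.proj j ∘ₗ i ∘ₗ f)
  refine ⟨q ∘ₗ LinearMap.pi g, ?_⟩
  have : LinearMap.pi g ∘ₗ (LinearMap.ker p).subtype = i ∘ₗ f :=
    LinearMap.ext fun x => funext fun j => LinearMap.congr_fun (hg j) x
  rw [LinearMap.comp_assoc, this, ← LinearMap.comp_assoc, hq, LinearMap.id_comp]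

theorem extZero_of_injective [Module.Injective A M] : ExtZero A C M := by
  have : Injective (ModuleCat.of A M) := Module.injective_object_of_injective_module A M
  exact subsingleton_of_forall_eq 0 fun e => Abelian.Ext.eq_zero_of_injective e

theorem extZero_of_projective [Module.Projective A C] : ExtZero A C M := by
  have : Projective (ModuleCat.of A C) := ModuleCat.projective_of_categoryTheory_projective _
  exact subsingleton_of_forall_eq 0 fun e => Abelian.Ext.eq_zero_of_projective e

theorem hasProjectiveDimensionLE_one {i : X →ₗ[A] Y} {p : Y →ₗ[A] Z} (hi : Function.Injective i)
    (h : Function.Exact i p) (hp : Function.Surjective p) [Module.Projective A X]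
    [Module.Projective A Y] : HasProjectiveDimensionLE (ModuleCat.of A Z) 1 := by
  have hX : Projective (ModuleCat.of A X) := ModuleCat.projective_of_categoryTheory_projective _
  have hY : Projective (ModuleCat.of A Y) := ModuleCat.projective_of_categoryTheory_projective _
  exact ((shortExact_shortComplexOfExact hi h hp).hasProjectiveDimensionLT_X₃_iff 0 hY).2
    (inferInstance : HasProjectiveDimensionLT (ModuleCat.of A X) 1)

theorem hasInjectiveDimensionLE_one {i : X →ₗ[A] Y} {p : Y →ₗ[A] Z} (hi : Function.Injective i)
    (h : Function.Exact i p) (hp : Function.Surjective p) [Module.Injective A Y]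
    [Module.Injective A Z] : HasInjectiveDimensionLE (ModuleCat.of A X) 1 := by
  have hY : Injective (ModuleCat.of A Y) := Module.injective_object_of_injective_module A Y
  have hZ : Injective (ModuleCat.of A Z) := Module.injective_object_of_injective_module A Z
  exact ((shortExact_shortComplexOfExact hi h hp).hasInjectiveDimensionLT_X₃_iff 0 hY).1
    (inferInstance : HasInjectiveDimensionLT (ModuleCat.of A Z) 1)

theorem hasProjectiveDimensionLE_of_retract {n : ℕ} (i : X →ₗ[A] Y) (p : Y →ₗ[A] X)
    (h : p ∘ₗ i = LinearMap.id) [HasProjectiveDimensionLE (ModuleCat.of A Y) n] :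
    HasProjectiveDimensionLE (ModuleCat.of A X) n :=
  Retract.hasProjectiveDimensionLT (X := ModuleCat.of A X) (Y := ModuleCat.of A Y)
    ⟨ModuleCat.ofHom i, ModuleCat.ofHom p, ModuleCat.hom_ext h⟩ (n + 1)

theorem exists_factor_through_cokernel {i : X →ₗ[A] Y} {p : Y →ₗ[A] Z} (h : Function.Exact i p)
    (hp : Function.Surjective p) (u : Y →ₗ[A] M) (hu : u ∘ₗ i = 0) :
    ∃ v : Z →ₗ[A] M, v ∘ₗ p = u := by
  have hle : LinearMap.ker p ≤ LinearMap.ker u := by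
    rw [h.linearMap_ker_eq]
    rintro _ ⟨x, rfl⟩
    exact LinearMap.congr_fun hu x
  refine ⟨(LinearMap.ker p).liftQ u hle ∘ₗ (p.quotKerEquivOfSurjective hp).symm.toLinearMap, ?_⟩
  ext y
  have : (p.quotKerEquivOfSurjective hp).symm (p y) = (LinearMap.ker p).mkQ y :=
    (LinearEquiv.symm_apply_eq _).2 rfl
  simp [this]

theorem exists_factor_through_kernel {i : X →ₗ[A] Y} {p : Y →ₗ[A] Z} (hi : Function.Injective i)
    (h : Function.Exact i p) (u : M →ₗ[A] Y) (hu : p ∘ₗ u = 0) :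
    ∃ v : M →ₗ[A] X, i ∘ₗ v = u := by
  have hmem : ∀ x, u x ∈ LinearMap.range i := fun x => (h (u x)).1 (LinearMap.congr_fun hu x)
  refine ⟨(LinearEquiv.ofInjective i hi).symm.toLinearMap ∘ₗ u.codRestrict _ hmem, ?_⟩
  ext x
  exact congrArg Subtype.val ((LinearEquiv.ofInjective i hi).apply_symm_apply ⟨u x, hmem x⟩)

/-- The kernel of a map inducing a surjection on `Hom(T, -)` has no extensions by `T`. -/
theorem ExtZero.of_exact_right {i : X →ₗ[A] Y} {p : Y →ₗ[A] Z} (hi : Function.Injective i)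
    (h : Function.Exact i p) (hext : ExtZero A T Y)
    (hlift : ∀ f : T →ₗ[A] Z, ∃ g : T →ₗ[A] Y, p ∘ₗ g = f) : ExtZero A T X := by
  obtain ⟨P, q, _, hq⟩ := exists_projective_surjection A T
  have hex : Function.Exact (LinearMap.ker q).subtype q := LinearMap.exact_subtype_ker_map q
  refine extZero_of_exists_extension (Submodule.injective_subtype _) hex hq fun f => ?_
  obtain ⟨u, hu⟩ := hext.exists_extension (Submodule.injective_subtype _) hex hq (i ∘ₗ f)
  obtain ⟨v, hv⟩ := exists_factor_through_cokernel hex hq (p ∘ₗ u) (by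
    rw [LinearMap.comp_assoc, hu, ← LinearMap.comp_assoc, h.linearMap_comp_eq_zero,
      LinearMap.zero_comp])
  obtain ⟨g, rfl⟩ := hlift v
  -- Correcting `u` by a lift `g` of the induced map `T → Z` makes it land in `X` without changing
  -- it on the kernel of `q`.
  obtain ⟨w, hw⟩ := exists_factor_through_kernel hi h (u - g ∘ₗ q) (by
    rw [LinearMap.comp_sub, ← LinearMap.comp_assoc, hv, sub_self])
  refine ⟨w, LinearMap.ext fun x => hi ?_⟩
  have h1 : i (w x) = u x - g (q x) := LinearMap.congr_fun hw x
  have h2 : u x = i (f x) := LinearMap.congr_fun hu x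
  have h3 : q x = 0 := x.2
  simpa [h3, h2] using h1

/-- The cokernel of a map inducing a surjection on `Hom(-, T)` has no extensions by `T`. -/
theorem ExtZero.of_exact_left {i : X →ₗ[A] Y} {p : Y →ₗ[A] Z} (h : Function.Exact i p)
    (hp : Function.Surjective p) (hext : ExtZero A Y T)
    (hextend : ∀ f : X →ₗ[A] T, ∃ g : Y →ₗ[A] T, g ∘ₗ i = f) : ExtZero A Z T := by
  obtain ⟨E, ι, _, hι⟩ := exists_injective_embedding A T
  have hex := LinearMap.exact_map_mkQ_range ι
  have hs := Submodule.mkQ_surjective (LinearMap.range ι)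
  refine extZero_of_exists_lift hι hex hs fun f => ?_
  obtain ⟨u, hu⟩ := hext.exists_lift hι hex hs (f ∘ₗ p)
  obtain ⟨v, hv⟩ := exists_factor_through_kernel hι hex (u ∘ₗ i) (by
    rw [← LinearMap.comp_assoc, hu, LinearMap.comp_assoc, h.linearMap_comp_eq_zero,
      LinearMap.comp_zero])
  obtain ⟨g, rfl⟩ := hextend v
  -- Correcting `u` by an extension `g` of the induced map `X → T` makes it descend to `Z` without
  -- changing it modulo the range of `ι`.
  obtain ⟨w, hw⟩ := exists_factor_through_cokernel h hp (u - ι ∘ₗ g) (by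
    rw [LinearMap.sub_comp, LinearMap.comp_assoc, hv, sub_self])
  refine ⟨w, LinearMap.ext fun z => ?_⟩
  obtain ⟨y, rfl⟩ := hp z
  have h1 : w (p y) = u y - ι (g y) := LinearMap.congr_fun hw y
  have h2 : (LinearMap.range ι).mkQ (u y) = f (p y) := LinearMap.congr_fun hu y
  rw [LinearMap.comp_apply, h1, map_sub, h2, hex.apply_apply_eq_zero, sub_zero]

end Extensions

/-! ### The two splitting lemmas behind the theorem -/

section Lifting

variable {A : Type u} [Ring A] {U Q₀ C X Y Z Q D : Type u} [AddCommGroup U] [Module A U]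
  [AddCommGroup Q₀] [Module A Q₀] [AddCommGroup C] [Module A C] [AddCommGroup X] [Module A X]
  [AddCommGroup Y] [Module A Y] [AddCommGroup Z] [Module A Z] [AddCommGroup Q] [Module A Q]
  [AddCommGroup D] [Module A D]

/-- If `0 → U → Q₀ → C → 0` is exact with `U` and `Q₀` projective, then maps from `C` lift along
surjections whose kernel is generated by an injective module. -/
theorem exists_lift_of_gen [Module.Projective A U] [Module.Projective A Q₀] [Module.Injective A Q]
    {ι : U →ₗ[A] Q₀} {π : Q₀ →ₗ[A] C} (hι : Function.Injective ι) (hex : Function.Exact ι π)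
    (hπ : Function.Surjective π) {i : X →ₗ[A] Y} {p : Y →ₗ[A] Z} (hi : Function.Injective i)
    (h : Function.Exact i p) (hp : Function.Surjective p) (hX : Gen A Q X) (f : C →ₗ[A] Z) :
    ∃ g : C →ₗ[A] Y, p ∘ₗ g = f := by
  obtain ⟨m, r, hr⟩ := hX
  obtain ⟨u, hu⟩ := Module.projective_lifting_property p (f ∘ₗ π) hp
  obtain ⟨v, hv⟩ := exists_factor_through_kernel hi h (u ∘ₗ ι) (by
    rw [← LinearMap.comp_assoc, hu, LinearMap.comp_assoc, hex.linearMap_comp_eq_zero,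
      LinearMap.comp_zero])
  -- `v : U → X` is the obstruction to `u` descending to `C`. It lifts to a power of `Q`, then
  -- extends to `Q₀`, and subtracting that extension removes it.
  obtain ⟨v', hv'⟩ := Module.projective_lifting_property r v hr
  obtain ⟨w, hw⟩ := Module.Injective.out ι hι v'
  obtain ⟨g, hg⟩ := exists_factor_through_cokernel hex hπ (u - i ∘ₗ r ∘ₗ w) (by
    refine LinearMap.ext fun x => ?_
    have h1 : r (v' x) = v x := LinearMap.congr_fun hv' x
    have h2 : i (v x) = u (ι x) := LinearMap.congr_fun hv x
    simp [hw, h1, h2])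
  refine ⟨g, LinearMap.ext fun c => ?_⟩
  obtain ⟨q, rfl⟩ := hπ c
  have h1 : g (π q) = u q - i (r (w q)) := LinearMap.congr_fun hg q
  have h2 : p (u q) = f (π q) := LinearMap.congr_fun hu q
  rw [LinearMap.comp_apply, h1, map_sub, h2, h.apply_apply_eq_zero, sub_zero]

/-- If `0 → C → Q₀ → D → 0` is exact with `Q₀` and `D` injective, then maps to `C` extend along
injections whose cokernel is cogenerated by a projective module. -/
theorem exists_extension_of_cogen [Module.Injective A D] [Module.Injective A Q₀]
    [Module.Projective A Q] {ι : C →ₗ[A] Q₀} {π : Q₀ →ₗ[A] D} (hι : Function.Injective ι)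
    (hex : Function.Exact ι π) (hπ : Function.Surjective π) {i : X →ₗ[A] Y} {p : Y →ₗ[A] Z}
    (hi : Function.Injective i) (h : Function.Exact i p) (hp : Function.Surjective p)
    (hZ : Cogen A Q Z) (f : X →ₗ[A] C) : ∃ g : Y →ₗ[A] C, g ∘ₗ i = f := by
  obtain ⟨m, s, hs⟩ := hZ
  obtain ⟨u, hu⟩ := Module.Injective.out i hi (ι ∘ₗ f)
  obtain ⟨v, hv⟩ := exists_factor_through_cokernel h hp (π ∘ₗ u) (by
    refine LinearMap.ext fun x => ?_
    simp [hu, hex.apply_apply_eq_zero])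
  -- Here the obstruction is `v : Z → D`; it extends to a power of `Q` because `D` is injective, and
  -- lifts to `Q₀` because that power is projective.
  obtain ⟨v', hv'⟩ := Module.Injective.out s hs v
  have : Module.Projective A (Fin m → Q) := projective_pi
  obtain ⟨w, hw⟩ := Module.projective_lifting_property π v' hπ
  obtain ⟨g, hg⟩ := exists_factor_through_kernel hι hex (u - w ∘ₗ s ∘ₗ p) (by
    refine LinearMap.ext fun y => ?_
    have h1 : π (w (s (p y))) = v' (s (p y)) := LinearMap.congr_fun hw _
    have h2 : v (p y) = π (u y) := LinearMap.congr_fun hv y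
    simp [h1, hv', h2])
  refine ⟨g, LinearMap.ext fun x => hι ?_⟩
  have h1 : ι (g (i x)) = u (i x) - w (s (p (i x))) := LinearMap.congr_fun hg _
  rw [LinearMap.comp_apply, h1, h.apply_apply_eq_zero, hu]
  simp

end Lifting

/-! ### Left and right approximations by powers of a module -/

section Approximations

variable {A : Type u} [Ring A] {T M C : Type u} [AddCommGroup T] [Module A T] [AddCommGroup M]
  [Module A M]
  [AddCommGroup C] [Module A C]

/-- Right approximations by powers of `T`. -/
theorem exists_right_approximation (R : Type u) [CommRing R] [IsArtinianRing R] [Algebra R A]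
    [Module.Finite R A] [Module.Finite A T] [Module.Finite A M]
    (hM : Gen A T M) :
    ∃ (n : ℕ) (p : (Fin n → T) →ₗ[A] M), Function.Surjective p ∧
      ∀ f : T →ₗ[A] M, ∃ g : T →ₗ[A] (Fin n → T), p ∘ₗ g = f := by
  classical
  obtain ⟨n, h, hh⟩ := exists_hom_generators R (A := A) (M := T) (N := M)
  have hlift : ∀ f : T →ₗ[A] M, ∃ g : T →ₗ[A] (Fin n → T), coprodMap h ∘ₗ g = f := fun f => by
    obtain ⟨b, hb⟩ := (hh f).2
    exact ⟨LinearMap.pi b, by rw [hb, coprodMap_comp_pi]⟩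
  refine ⟨n, coprodMap h, ?_, hlift⟩
  obtain ⟨m, F, hF⟩ := hM
  choose g hg using fun j => hlift (F ∘ₗ LinearMap.single A (fun _ : Fin m => T) j)
  have hFg : F = coprodMap h ∘ₗ coprodMap g := by
    refine LinearMap.pi_ext' fun j => ?_
    rw [← hg j, LinearMap.comp_assoc, coprodMap_comp_single]
  rw [hFg] at hF
  exact Function.Surjective.of_comp (g := coprodMap g) hF

/-- Left approximations by powers of `T`. -/
theorem exists_left_approximation (R : Type u) [CommRing R] [IsArtinianRing R] [Algebra R A]
    [Module.Finite R A] [Module.Finite A T] [Module.Finite A M]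
    (hM : Cogen A T M) :
    ∃ (n : ℕ) (i : M →ₗ[A] (Fin n → T)), Function.Injective i ∧
      ∀ f : M →ₗ[A] T, ∃ g : (Fin n → T) →ₗ[A] T, g ∘ₗ i = f := by
  obtain ⟨n, h, hh⟩ := exists_hom_generators R (A := A) (M := M) (N := T)
  have hextend : ∀ f : M →ₗ[A] T, ∃ g : (Fin n → T) →ₗ[A] T, g ∘ₗ LinearMap.pi h = f := fun f => by
    obtain ⟨b, hb⟩ := (hh f).1
    exact ⟨coprodMap b, by rw [hb, coprodMap_comp_pi]⟩
  refine ⟨n, LinearMap.pi h, ?_, hextend⟩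
  obtain ⟨m, F, hF⟩ := hM
  intro x y hxy
  refine hF (funext fun j => ?_)
  obtain ⟨g, hg⟩ := hextend (LinearMap.proj j ∘ₗ F)
  have hx : g (LinearMap.pi h x) = F x j := LinearMap.congr_fun hg x
  have hy : g (LinearMap.pi h y) = F y j := LinearMap.congr_fun hg y
  rw [← hx, ← hy, hxy]

end Approximations

/-! ### Tilting and cotilting modules versus (co)presentations -/

section Tilting

variable {A : Type u} [Ring A] {Q T T₀ T₁ M D : Type u} [AddCommGroup Q] [Module A Q]
  [AddCommGroup T] [Module A T] [AddCommGroup T₀] [Module A T₀] [AddCommGroup T₁] [Module A T₁]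
  [AddCommGroup M] [Module A M] [AddCommGroup D] [Module A D]

theorem Gen.finite (h : Gen A Q M) [Module.Finite A Q] : Module.Finite A M := by
  obtain ⟨m, f, hf⟩ := h
  exact Module.Finite.of_surjective f hf

/-- As Ext¹ from `T₁` to `M` vanishes, the map `A → M` sending 1 to a given element extends to `T₀`,
which is generated by `T`. -/
theorem gen_of_extZero [Module.Finite A M] {f : A →ₗ[A] T₀} {g : T₀ →ₗ[A] T₁}
    (hf : Function.Injective f) (hfg : Function.Exact f g) (hg : Function.Surjective g)
    (hT₀ : InAdd A T T₀) (hT₁ : InAdd A T T₁) (hM : ExtZero A T M) : Gen A T M := by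
  obtain ⟨k, p, hp⟩ := hT₀.gen
  refine gen_of_forall_mem_range fun x => ?_
  obtain ⟨u, hu⟩ := (hM.of_inAdd_left hT₁).exists_extension hf hfg hg
    (LinearMap.toSpanSingleton A M x)
  obtain ⟨y, hy⟩ := hp (f 1)
  refine ⟨k, u ∘ₗ p, y, ?_⟩
  rw [LinearMap.comp_apply, hy]
  simpa using LinearMap.congr_fun hu 1

/-- As Ext¹ from `M` to `T₀` vanishes, maps `M → D` lift to `T₁`; these maps separate points and
`T₁` is cogenerated by `T`. -/
theorem cogen_of_extZero [IsArtinian A M] {f : T₀ →ₗ[A] T₁} {g : T₁ →ₗ[A] D}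
    (hf : Function.Injective f) (hfg : Function.Exact f g) (hg : Function.Surjective g)
    (hT₀ : InAdd A T T₀) (hT₁ : InAdd A T T₁) (hM : ExtZero A M T)
    (hD : ∀ x : M, x ≠ 0 → ∃ φ : M →ₗ[A] D, φ x ≠ 0) : Cogen A T M := by
  obtain ⟨k, p, hp⟩ := hT₁.cogen
  refine cogen_of_forall_ne_zero fun x hx => ?_
  obtain ⟨φ, hφ⟩ := hD x hx
  obtain ⟨u, hu⟩ := (hM.of_inAdd_right hT₀).exists_lift hf hfg hg φ
  have hux : p (u x) ≠ 0 := by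
    intro h0
    rw [map_eq_zero_iff p hp] at h0
    exact hφ (by rw [← hu, LinearMap.comp_apply, h0, map_zero])
  obtain ⟨j, hj⟩ := Function.ne_iff.1 hux
  exact ⟨LinearMap.proj j ∘ₗ p ∘ₗ u, hj⟩

/-- The cokernel of an embedding of `A` in a power of `Q` turns out to be a summand of a power of
`T`, because its right approximation by `T` splits. It therefore embeds in a power of `Q`. -/
theorem hasProjInjCopresentation_of_extZero (R : Type u) [CommRing R] [IsArtinianRing R]
    [Algebra R A] [Module.Finite R A] (hQ : IsFinProjInj A Q) (hgen : Gen A Q T)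
    (hcogen : Cogen A Q T) {f : A →ₗ[A] T₀} {g : T₀ →ₗ[A] T₁}
    (hf : Function.Injective f) (hfg : Function.Exact f g) (hg : Function.Surjective g)
    (hT₀ : InAdd A T T₀) (hT₁ : InAdd A T T₁) (hT : ExtZero A T T) :
    HasProjInjCopresentation A := by
  have : IsArtinianRing A := IsArtinianRing.of_finite R A
  have := hQ.finite
  have := hQ.injective
  have := hQ.projective
  have : Module.Finite A T := hgen.finite
  obtain ⟨m, ι, hι⟩ := (hcogen.trans hT₀.cogen).of_injective f hf
  have hQ₀ : IsFinProjInj A (Fin m → Q) := IsFinProjInj.pi fun _ => hQ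
  have := hQ₀.projective
  have hex := LinearMap.exact_map_mkQ_range ι
  have hπ := Submodule.mkQ_surjective (LinearMap.range ι)
  have hTQ : Gen A T Q := gen_of_extZero hf hfg hg hT₀ hT₁ extZero_of_injective
  have hTC : Gen A T ((Fin m → Q) ⧸ LinearMap.range ι) :=
    (gen_pi (F := fun _ : Fin m => Q) fun _ => hTQ).of_surjective _ hπ
  obtain ⟨n, p, hp, hlift⟩ := exists_right_approximation R hTC
  have hexp : Function.Exact (LinearMap.ker p).subtype p := LinearMap.exact_subtype_ker_map p
  have hinj := (LinearMap.ker p).injective_subtype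
  have hK : Gen A Q (LinearMap.ker p) := hgen.trans <|
    gen_of_extZero hf hfg hg hT₀ hT₁ <| ExtZero.of_exact_right hinj hexp
      (hT.of_inAdd_right (inAdd_pi (F := fun _ : Fin n => T) fun _ => inAdd_self)) hlift
  -- Lifting the identity of the cokernel splits the approximation.
  obtain ⟨s, hs⟩ := exists_lift_of_gen hι hex hπ hinj hexp hp hK LinearMap.id
  obtain ⟨k, q, hq⟩ := (cogen_pi (F := fun _ : Fin n => T) fun _ => hcogen).of_injective s
    (injective_of_comp_eq_id hs)
  refine ⟨ModuleCat.of A (Fin m → Q), ModuleCat.of A (Fin k → Q), ι,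
    q ∘ₗ (LinearMap.range ι).mkQ, hQ₀, IsFinProjInj.pi fun _ => hQ, hι, fun x => ?_⟩
  rw [LinearMap.comp_apply, map_eq_zero_iff q hq]
  exact hex x

variable (A) in
theorem hasProjInjCopresentation_of_isTilting (R : Type u) [CommRing R] [IsArtinianRing R]
    [Algebra R A] [Module.Finite R A] {T : ModuleCat.{u} A} (hC : MemC A T) (hT : IsTilting A T) :
    HasProjInjCopresentation A := by
  have : IsArtinianRing A := IsArtinianRing.of_finite R A
  obtain ⟨_, t, Q, hQ, hgen, hcogen⟩ := hC
  obtain ⟨T₀, T₁, f, g, hT₀, hT₁, hf, hfg, hg⟩ := hT.exists_coresolution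
  exact hasProjInjCopresentation_of_extZero R hQ.isFinProjInj hgen hcogen hf hfg hg hT₀ hT₁
    hT.ext_eq_zero

theorem exact_inr_comp_prodMap {f : M →ₗ[A] T₀} {g : T₀ →ₗ[A] T₁} (h : Function.Exact f g) :
    Function.Exact (LinearMap.inr A Q T₀ ∘ₗ f) ((LinearMap.id : Q →ₗ[A] Q).prodMap g) := by
  rintro ⟨q, x⟩
  constructor
  · intro hx
    obtain ⟨hq, hx⟩ := Prod.mk.inj hx
    obtain ⟨y, rfl⟩ := (h x).1 hx
    exact ⟨y, Prod.ext hq.symm rfl⟩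
  · rintro ⟨y, hy⟩
    obtain ⟨rfl, rfl⟩ := Prod.mk.inj hy
    exact Prod.ext rfl (h.apply_apply_eq_zero y)

theorem exact_prodMap_comp_snd {f : M →ₗ[A] T₀} {g : T₀ →ₗ[A] T₁} (h : Function.Exact f g) :
    Function.Exact ((LinearMap.id : Q →ₗ[A] Q).prodMap f) (g ∘ₗ LinearMap.snd A Q T₀) := by
  rintro ⟨q, x⟩
  constructor
  · intro hx
    obtain ⟨y, rfl⟩ := (h x).1 hx
    exact ⟨(q, y), rfl⟩
  · rintro ⟨⟨q', y⟩, hy⟩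
    obtain ⟨rfl, rfl⟩ := Prod.mk.inj hy
    exact h.apply_apply_eq_zero y

variable (A) in
theorem exists_isTilting_of_hasProjInjCopresentation [IsArtinianRing A]
    (h : HasProjInjCopresentation A) : ∃ T : ModuleCat.{u} A, MemC A T ∧ IsTilting A T := by
  obtain ⟨Q₀, Q₁, f, g, hQ₀, hQ₁, hf, hfg⟩ := h
  obtain ⟨t, Qf, hQf⟩ := exists_isProjInjReps A
  have hQ := hQf.isFinProjInj
  have := hQ.finite
  have := hQ.injective
  have := hQ.projective
  have := hQ₀.finite
  have := hQ₀.projective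
  have haddQ₀ := hQf.inAdd hQ₀
  have hex := LinearMap.exact_map_mkQ_range f
  have hπ := Submodule.mkQ_surjective (LinearMap.range f)
  have hexT := exact_inr_comp_prodMap (Q := ∀ i, Qf i) hex
  have hπT : Function.Surjective
      ((LinearMap.id : (∀ i, Qf i) →ₗ[A] _).prodMap (LinearMap.range f).mkQ) :=
    Function.surjective_id.prodMap hπ
  have hfT : Function.Injective (LinearMap.inr A (∀ i, Qf i) Q₀ ∘ₗ f) :=
    LinearMap.inr_injective.comp hf
  -- The summand `∀ i, Qf i` is included so that `Q₀` lies in the additive closure, which makes `0 →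
  -- A → Q₀ → Q₀ ⧸ range f → 0` the required coresolution.
  obtain ⟨T, hbasic, hadd, i, p, hp⟩ :=
    exists_isBasic_retract (A := A) ((∀ i, Qf i) × (Q₀ ⧸ LinearMap.range f))
  have hgen : Gen A (∀ i, Qf i) T := (gen_prod inAdd_self.gen
    (haddQ₀.gen.of_surjective _ hπ)).of_surjective p (surjective_of_comp_eq_id hp)
  have hcoker : Cogen A (∀ i, Qf i) (Q₀ ⧸ LinearMap.range f) := by
    refine (hQf.inAdd hQ₁).cogen.of_injective ((LinearMap.range f).liftQ g ?_) ?_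
    · exact hfg.linearMap_ker_eq.ge
    · exact LinearMap.ker_eq_bot.1 (Submodule.ker_liftQ_eq_bot _ _ _ hfg.linearMap_ker_eq.le)
  have hcogen : Cogen A (∀ i, Qf i) T :=
    (cogen_prod inAdd_self.cogen hcoker).of_injective i (injective_of_comp_eq_id hp)
  have hfin : Module.Finite A T := hgen.finite
  have hpd := hasProjectiveDimensionLE_one hfT hexT hπT
  have hext : ExtZero A ((∀ i, Qf i) × (Q₀ ⧸ LinearMap.range f)) T := by
    obtain ⟨E, ι, _, hι⟩ := exists_injective_embedding A T
    exact extZero_of_exists_lift hι (LinearMap.exact_map_mkQ_range ι) (Submodule.mkQ_surjective _)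
      fun φ => exists_lift_of_gen hfT hexT hπT hι (LinearMap.exact_map_mkQ_range ι)
        (Submodule.mkQ_surjective _) hgen φ
  refine ⟨T, ⟨hfin, t, Qf, hQf, hgen, hcogen⟩, hfin, hbasic,
    hasProjectiveDimensionLE_of_retract i p hp, hext.of_inAdd_left (inAdd_of_retract i p hp),
    Q₀, ModuleCat.of A (Q₀ ⧸ LinearMap.range f), f, (LinearMap.range f).mkQ, ?_, ?_, hf, hex, hπ⟩
  · exact (hadd.trans (inAdd_of_retract (LinearMap.inl A _ _) (LinearMap.fst A _ _)
      (LinearMap.fst_comp_inl _ _ _))).trans haddQ₀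
  · exact hadd.trans (inAdd_of_retract (LinearMap.inr A _ _) (LinearMap.snd A _ _)
      (LinearMap.snd_comp_inr _ _ _))

variable (A D) in
/-- `D` has a presentation by finitely generated projective-injective modules. -/
def HasProjInjPresentation : Prop :=
  ∃ (Q₀ Q₁ : ModuleCat.{u} A) (g : Q₁ →ₗ[A] Q₀) (f : Q₀ →ₗ[A] D), IsFinProjInj A Q₀ ∧
    IsFinProjInj A Q₁ ∧ Function.Exact g f ∧ Function.Surjective f

/-- Dual to `hasProjInjCopresentation_of_extZero`: the kernel of an epimorphism from a power of `Q`
to the injective cogenerator `D` is a summand of a power of `T`, hence generated by `Q`. -/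
theorem hasProjInjPresentation_of_extZero (R : Type u) [CommRing R] [IsArtinianRing R]
    [Algebra R A] [Module.Finite R A] (hQ : IsFinProjInj A Q) (hgen : Gen A Q T)
    (hcogen : Cogen A Q T) [Module.Injective A D]
    (hD : ∀ (M : ModuleCat.{u} A) (x : M), x ≠ 0 → ∃ φ : M →ₗ[A] D, φ x ≠ 0)
    {f : T₀ →ₗ[A] T₁} {g : T₁ →ₗ[A] D}
    (hf : Function.Injective f) (hfg : Function.Exact f g) (hg : Function.Surjective g)
    (hT₀ : InAdd A T T₀) (hT₁ : InAdd A T T₁) (hT : ExtZero A T T) :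
    HasProjInjPresentation A D := by
  have : IsArtinianRing A := IsArtinianRing.of_finite R A
  have := hQ.finite
  have := hQ.injective
  have := hQ.projective
  have : Module.Finite A T := hgen.finite
  obtain ⟨m, π, hπ⟩ := (hgen.trans hT₁.gen).of_surjective g hg
  have hQ₀ : IsFinProjInj A (Fin m → Q) := IsFinProjInj.pi fun _ => hQ
  have := hQ₀.finite
  have := hQ₀.injective
  have hex : Function.Exact (LinearMap.ker π).subtype π := LinearMap.exact_subtype_ker_map π
  have hι := (LinearMap.ker π).injective_subtype
  have hTQ : Cogen A T Q :=
    cogen_of_extZero hf hfg hg hT₀ hT₁ extZero_of_projective (hD (ModuleCat.of A Q))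
  have hTC : Cogen A T (LinearMap.ker π) :=
    (cogen_pi (F := fun _ : Fin m => Q) fun _ => hTQ).of_injective _ hι
  obtain ⟨n, i, hi, hextend⟩ := exists_left_approximation R hTC
  have hexi := LinearMap.exact_map_mkQ_range i
  have hsurj := Submodule.mkQ_surjective (LinearMap.range i)
  have hZ : Cogen A Q ((Fin n → T) ⧸ LinearMap.range i) := hcogen.trans <|
    cogen_of_extZero hf hfg hg hT₀ hT₁ (ExtZero.of_exact_left hexi hsurj
      (hT.of_inAdd_left (inAdd_pi (F := fun _ : Fin n => T) fun _ => inAdd_self)) hextend)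
      (hD (ModuleCat.of A _))
  obtain ⟨s, hs⟩ := exists_extension_of_cogen hι hex hπ hi hexi hsurj hZ LinearMap.id
  obtain ⟨k, q, hq⟩ := (gen_pi (F := fun _ : Fin n => T) fun _ => hgen).of_surjective s
    (surjective_of_comp_eq_id hs)
  refine ⟨ModuleCat.of A (Fin m → Q), ModuleCat.of A (Fin k → Q),
    (LinearMap.ker π).subtype ∘ₗ q, π, hQ₀, IsFinProjInj.pi fun _ => hQ, ?_, hπ⟩
  rw [LinearMap.exact_iff, LinearMap.range_comp_of_range_eq_top _ (LinearMap.range_eq_top.2 hq),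
    Submodule.range_subtype]

/-- The module is the sum of all projective-injectives and the kernel of `Q₀ → D`. It is not cut
down to a basic summand, since `IsCotilting` does not ask for one. -/
theorem exists_of_hasProjInjPresentation [IsArtinianRing A] [Module.Injective A D]
    (h : HasProjInjPresentation A D) : ∃ C : ModuleCat.{u} A, MemC A C ∧
      HasInjectiveDimensionLE (ModuleCat.of A C) 1 ∧ ExtZero A C C ∧
      ∃ (C₀ C₁ : ModuleCat.{u} A) (f : C₀ →ₗ[A] C₁) (g : C₁ →ₗ[A] D), InAdd A C C₀ ∧
        InAdd A C C₁ ∧ Function.Injective f ∧ Function.Exact f g ∧ Function.Surjective g := by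
  obtain ⟨Q₀, Q₁, g, f, hQ₀, hQ₁, hgf, hf⟩ := h
  obtain ⟨t, Qf, hQf⟩ := exists_isProjInjReps A
  have hQ := hQf.isFinProjInj
  have := hQ.finite
  have := hQ.injective
  have := hQ.projective
  have := hQ₀.finite
  have := hQ₀.injective
  have := (hQ.prod hQ₀).injective
  have haddQ₀ := hQf.inAdd hQ₀
  have hex : Function.Exact (LinearMap.ker f).subtype f := LinearMap.exact_subtype_ker_map f
  have hι := (LinearMap.ker f).injective_subtype
  have hexC := exact_prodMap_comp_snd (Q := ∀ i, Qf i) hex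
  have hιC : Function.Injective
      ((LinearMap.id : (∀ i, Qf i) →ₗ[A] _).prodMap (LinearMap.ker f).subtype) :=
    Function.injective_id.prodMap hι
  have hfC : Function.Surjective (f ∘ₗ LinearMap.snd A (∀ i, Qf i) Q₀) :=
    hf.comp LinearMap.snd_surjective
  have hker : Gen A (∀ i, Qf i) (LinearMap.ker f) := by
    refine (hQf.inAdd hQ₁).gen.of_surjective (g.codRestrict _ fun x =>
      hgf.apply_apply_eq_zero x) ?_
    rintro ⟨x, hx⟩
    obtain ⟨y, rfl⟩ := (hgf x).1 hx
    exact ⟨y, rfl⟩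
  have hgen := gen_prod (inAdd_self (A := A) (X := ∀ i, Qf i)).gen hker
  have hcogen := cogen_prod (inAdd_self (A := A) (X := ∀ i, Qf i)).cogen
    (haddQ₀.cogen.of_injective _ hι)
  refine ⟨ModuleCat.of A ((∀ i, Qf i) × LinearMap.ker f), ⟨hgen.finite, t, Qf, hQf, hgen, hcogen⟩,
    hasInjectiveDimensionLE_one hιC hexC hfC, ?_, ModuleCat.of A (LinearMap.ker f), Q₀,
    (LinearMap.ker f).subtype, f, ?_, ?_, hι, hex, hf⟩
  · obtain ⟨P, p, _, hp⟩ := exists_projective_surjection A ((∀ i, Qf i) × LinearMap.ker f)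
    have hexp : Function.Exact (LinearMap.ker p).subtype p := LinearMap.exact_subtype_ker_map p
    have hinj := (LinearMap.ker p).injective_subtype
    exact extZero_of_exists_extension hinj hexp hp fun φ =>
      exists_extension_of_cogen hιC hexC hfC hinj hexp hp hcogen φ
  · exact inAdd_of_retract (LinearMap.inr A _ _) (LinearMap.snd A _ _)
      (LinearMap.snd_comp_inr _ _ _)
  · exact (inAdd_of_retract (LinearMap.inl A _ _) (LinearMap.fst A _ _)
      (LinearMap.fst_comp_inl _ _ _)).trans haddQ₀

end Tilting

/-! ### Matlis duality over a commutative artinian ring -/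

section Matlis

variable {R : Type u} [CommRing R] {J : Type u} [AddCommGroup J] [Module R J]
  {j : (R ⧸ Ring.jacobson R) →ₗ[R] J}

/-- Over an artinian ring, the injective envelope of `R / rad R` is a cogenerator. -/
theorem IsInjectiveEnvelope.exists_apply_ne_zero [IsArtinianRing R]
    (hj : IsInjectiveEnvelope R j) {M : Type u} [AddCommGroup M] [Module R M] (x : M)
    (hx : x ≠ 0) : ∃ f : M →ₗ[R] J, f x ≠ 0 := by
  have := hj.injective_module
  have hI : LinearMap.ker (LinearMap.toSpanSingleton R M x) ≠ ⊤ := fun h => hx (by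
    have : (1 : R) ∈ LinearMap.ker (LinearMap.toSpanSingleton R M x) := h ▸ Submodule.mem_top
    simpa using this)
  obtain ⟨m, hm, hle⟩ := Ideal.exists_le_maximal _ hI
  have hjac : Ring.jacobson R ≤ m := by
    rw [Ring.jacobson_eq_sInf_isMaximal]
    exact sInf_le hm
  have hss : IsSemisimpleModule R (R ⧸ Ring.jacobson R) :=
    (IsArtinian.isSemisimpleModule_iff_jacobson R _).2 (Module.jacobson_quotient_jacobson R R)
  let φ : (R ⧸ Ring.jacobson R) →ₗ[R] (R ⧸ m) := Submodule.factor hjac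
  -- Semisimplicity of `R ⧸ rad R` makes its quotient `R ⧸ m` a summand. This gives a nonzero `y`
  -- killed by `m`, so sending `x` to `j y` is well defined on the span of `x`.
  obtain ⟨C, hC⟩ := exists_isCompl (LinearMap.ker φ)
  obtain ⟨k, hk, y, hy, hky⟩ := Submodule.mem_sup.1
    (hC.sup_eq_top ▸ Submodule.mem_top : (Submodule.Quotient.mk 1 : R ⧸ Ring.jacobson R) ∈ _)
  have hφy : φ y = Submodule.Quotient.mk 1 := by
    have h1 : φ (k + y) = Submodule.Quotient.mk 1 := by rw [hky]; rfl
    rwa [map_add, LinearMap.mem_ker.1 hk, zero_add] at h1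
  have hy0 : y ≠ 0 := by
    rintro rfl
    rw [map_zero, eq_comm, Submodule.Quotient.mk_eq_zero] at hφy
    exact hm.ne_top ((Ideal.eq_top_iff_one m).2 hφy)
  have hmy : ∀ r ∈ m, r • y = 0 := fun r hr => by
    have h1 : r • y ∈ LinearMap.ker φ := by
      rw [LinearMap.mem_ker, map_smul, hφy, ← Submodule.Quotient.mk_smul,
        Submodule.Quotient.mk_eq_zero]
      simpa using hr
    exact (Submodule.mem_bot R).1 (hC.inf_eq_bot ▸ ⟨h1, C.smul_mem r hy⟩)
  let t := LinearMap.toSpanSingleton R M x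
  have hle : LinearMap.ker t ≤ LinearMap.ker (LinearMap.toSpanSingleton R J (j y)) := by
    intro r hr
    rw [LinearMap.mem_ker, LinearMap.toSpanSingleton_apply, ← map_smul, hmy r (hle hr), map_zero]
  obtain ⟨f, hf⟩ := Module.Injective.out ((LinearMap.ker t).liftQ t le_rfl)
    (LinearMap.ker_eq_bot.1 (Submodule.ker_liftQ_eq_bot _ _ _ le_rfl))
    ((LinearMap.ker t).liftQ _ hle)
  refine ⟨f, ?_⟩
  have h1 : f (t 1) = LinearMap.toSpanSingleton R J (j y) 1 := hf (Submodule.Quotient.mk 1)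
  simp only [t, LinearMap.toSpanSingleton_apply, one_smul] at h1
  rw [h1, Ne, map_eq_zero_iff j hj.injective]
  exact hy0

/-- The dual of a simple module is zero or simple. Essentiality gives `s` with `f s` and `g s` both
in the image of `R ⧸ rad R`, where the two values can be compared by commutativity. -/
theorem IsInjectiveEnvelope.exists_smul_eq (hj : IsInjectiveEnvelope R j) {S : Type u}
    [AddCommGroup S] [Module R S] [IsSimpleModule R S] (f g : S →ₗ[R] J) (hf : f ≠ 0) :
    ∃ r : R, r • f = g := by
  have hmeet : ∀ h : S →ₗ[R] J, h ≠ 0 → ∃ (s : S) (x : R ⧸ Ring.jacobson R), h s = j x ∧ x ≠ 0 := by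
    intro h hh
    by_contra! hcon
    refine hh (LinearMap.range_eq_bot.1 (hj.essential _ ?_))
    rw [Submodule.eq_bot_iff]
    rintro _ ⟨⟨x, rfl⟩, ⟨s, hs⟩⟩
    rw [hcon s x hs, map_zero]
  obtain ⟨s, x, hs, hx⟩ := hmeet f hf
  have hs0 : s ≠ 0 := by
    rintro rfl
    rw [map_zero, eq_comm, map_eq_zero_iff j hj.injective] at hs
    exact hx hs
  obtain ⟨y, hy⟩ : ∃ y, g s = j y := by
    by_cases hg : g = 0
    · exact ⟨0, by simp [hg]⟩
    · obtain ⟨s', y, hs', hy⟩ := hmeet g hg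
      have hs'0 : s' ≠ 0 := by
        rintro rfl
        rw [map_zero, eq_comm, map_eq_zero_iff j hj.injective] at hs'
        exact hy hs'
      obtain ⟨b, rfl⟩ := IsSimpleModule.toSpanSingleton_surjective R hs'0 s
      exact ⟨b • y, by simp [hs']⟩
  obtain ⟨a, rfl⟩ := Submodule.Quotient.mk_surjective _ x
  obtain ⟨b, rfl⟩ := Submodule.Quotient.mk_surjective _ y
  -- Otherwise `a * a` lies in the radical, an intersection of prime ideals, and so does `a`,
  -- contradicting `x ≠ 0`.
  have has : a • s ≠ 0 := by
    intro h
    have h1 : j (Submodule.Quotient.mk (a * a)) = 0 := by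
      rw [← smul_eq_mul, Submodule.Quotient.mk_smul, map_smul, ← hs, ← map_smul, h, map_zero]
    rw [map_eq_zero_iff j hj.injective, Submodule.Quotient.mk_eq_zero] at h1
    refine hx ((Submodule.Quotient.mk_eq_zero _).2 ?_)
    rw [Ring.jacobson_eq_sInf_isMaximal, Submodule.mem_sInf] at h1 ⊢
    intro m hm
    exact (hm.isPrime.mem_or_mem (h1 m hm)).elim id id
  obtain ⟨r, hr⟩ := IsSimpleModule.toSpanSingleton_surjective R has s
  rw [LinearMap.toSpanSingleton_apply] at hr
  refine ⟨r * b, LinearMap.ext fun z => ?_⟩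
  obtain ⟨c, rfl⟩ := IsSimpleModule.toSpanSingleton_surjective R hs0 z
  have h1 : g s = (r * b) • f s := by
    conv_lhs => rw [← hr]
    rw [map_smul, map_smul, hy, hs, ← map_smul, ← map_smul, ← map_smul,
      ← Submodule.Quotient.mk_smul, ← Submodule.Quotient.mk_smul, ← Submodule.Quotient.mk_smul]
    congr 2
    simp only [smul_eq_mul]
    ring
  simp only [LinearMap.toSpanSingleton_apply, map_smul, h1, LinearMap.smul_apply]

/-- Left exactness of Hom into `J` and induction on length, each simple factor contributing at most
1. The inequality is enough for reflexivity: the double dual is no longer than `M`, which embeds in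
it. -/
theorem IsInjectiveEnvelope.length_le (hj : IsInjectiveEnvelope R j) {M : Type u}
    [AddCommGroup M] [Module R M] (hM : IsFiniteLength R M) :
    Module.length R (M →ₗ[R] J) ≤ Module.length R M := by
  induction hM with
  | of_subsingleton => 
    rw [Module.length_eq_zero]
    exact zero_le
  | @of_simple_quotient M _ _ N _ _ ih =>
    have h1 : Module.length R (M ⧸ N →ₗ[R] J) ≤ 1 := by
      by_cases h : Subsingleton (M ⧸ N →ₗ[R] J)
      · rw [Module.length_eq_zero]
        exact zero_le
      · rw [not_subsingleton_iff_nontrivial] at h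
        have : IsSimpleModule R (M ⧸ N →ₗ[R] J) := by
          refine (isSimpleModule_iff_toSpanSingleton_surjective).2 ⟨h, fun f hf g => ?_⟩
          exact hj.exists_smul_eq f g hf
        exact (Module.length_eq_one R _).le
    let a : (M ⧸ N →ₗ[R] J) →ₗ[R] (M →ₗ[R] J) := LinearMap.lcomp R J N.mkQ
    let b : (M →ₗ[R] J) →ₗ[R] (N →ₗ[R] J) := LinearMap.lcomp R J N.subtype
    have ha : Function.Injective a := fun f g hfg =>
      LinearMap.cancel_right N.mkQ_surjective |>.1 hfg
    have hex : Function.Exact a b.rangeRestrict := by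
      intro f
      rw [← LinearMap.mem_ker, LinearMap.ker_rangeRestrict]
      constructor
      · intro hf
        obtain ⟨v, hv⟩ := exists_factor_through_cokernel (LinearMap.exact_subtype_mkQ N)
          N.mkQ_surjective f hf
        exact ⟨v, hv⟩
      · rintro ⟨v, rfl⟩
        ext x
        have : N.mkQ (x : M) = 0 := (Submodule.Quotient.mk_eq_zero N).2 x.2
        exact (congrArg v this).trans (map_zero v)
    have hN : Module.length R M = Module.length R N + Module.length R (M ⧸ N) :=
      Module.length_eq_add_of_exact N.subtype N.mkQ N.injective_subtype N.mkQ_surjective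
        (LinearMap.exact_subtype_mkQ N)
    rw [Module.length_eq_add_of_exact a b.rangeRestrict ha b.surjective_rangeRestrict hex, hN,
      Module.length_eq_one R (M ⧸ N), add_comm]
    exact add_le_add ((Module.length_le_of_injective _ (LinearMap.range b).injective_subtype).trans
      ih) h1

variable {M : Type u} [AddCommGroup M] [Module R M] [Module.Finite R M] [IsArtinianRing R]

theorem IsInjectiveEnvelope.finite_hom (hj : IsInjectiveEnvelope R j) :
    Module.Finite R (M →ₗ[R] J) := by
  have hM : IsFiniteLength R M :=
    isFiniteLength_iff_isNoetherian_isArtinian.2 ⟨inferInstance, inferInstance⟩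
  have : IsFiniteLength R (M →ₗ[R] J) := Module.length_ne_top_iff.1
    (ne_top_of_le_ne_top Module.length_ne_top (hj.length_le hM))
  have := (isFiniteLength_iff_isNoetherian_isArtinian.1 this).1
  infer_instance

/-- Matlis duality: finitely generated modules are reflexive. -/
theorem IsInjectiveEnvelope.exists_eq_apply (hj : IsInjectiveEnvelope R j)
    (F : (M →ₗ[R] J) →ₗ[R] J) : ∃ x : M, ∀ f, F f = f x := by
  let ev : M →ₗ[R] (M →ₗ[R] J) →ₗ[R] J := LinearMap.applyₗ
  have hev : Function.Injective ev := by
    rw [← LinearMap.ker_eq_bot, Submodule.eq_bot_iff]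
    intro x hx
    by_contra hx0
    obtain ⟨f, hf⟩ := hj.exists_apply_ne_zero x hx0
    exact hf (LinearMap.congr_fun hx f)
  have := hj.finite_hom (M := M)
  have := hj.finite_hom (M := M →ₗ[R] J)
  have hlen : Module.length R ((M →ₗ[R] J) →ₗ[R] J) ≤ Module.length R M :=
    (hj.length_le (isFiniteLength_iff_isNoetherian_isArtinian.2
      ⟨inferInstance, inferInstance⟩)).trans (hj.length_le
        (isFiniteLength_iff_isNoetherian_isArtinian.2 ⟨inferInstance, inferInstance⟩))
  have hrange : LinearMap.range ev = ⊤ := by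
    by_contra h
    have h1 := Submodule.length_lt h
    rw [← (LinearEquiv.ofInjective ev hev).length_eq] at h1
    exact absurd h1 hlen.not_gt
  obtain ⟨x, hx⟩ := (hrange ▸ Submodule.mem_top : F ∈ LinearMap.range ev)
  exact ⟨x, fun f => by rw [← hx]; rfl⟩

/-- A functional on the dual of `M` that vanishes on `N` is evaluation at some `x` by reflexivity,
and separation forces `x = 0`. -/
theorem IsInjectiveEnvelope.eq_top_of_forall (hj : IsInjectiveEnvelope R j)
    (N : Submodule R (M →ₗ[R] J)) (hN : ∀ x : M, (∀ f ∈ N, f x = 0) → x = 0) : N = ⊤ := by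
  by_contra h
  obtain ⟨f, -, hf⟩ := SetLike.exists_of_lt (lt_top_iff_ne_top.2 h)
  obtain ⟨F, hF⟩ := hj.exists_apply_ne_zero (N.mkQ f) (by simpa using hf)
  obtain ⟨x, hx⟩ := hj.exists_eq_apply (F ∘ₗ N.mkQ)
  have hx0 : x = 0 := hN x fun g hg => by
    rw [← hx, LinearMap.comp_apply, show N.mkQ g = 0 from (Submodule.Quotient.mk_eq_zero N).2 hg,
      map_zero]
  exact hF ((hx f).trans (by rw [hx0, map_zero]))

end Matlis

/-! ### The dual `DA` as an injective cogenerator -/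

section DualModule

variable {R A : Type u} [CommRing R] [Ring A] [Algebra R A] {J : Type u} [AddCommGroup J]
  [Module R J] {M N : Type u} [AddCommGroup M] [Module A M] [Module R M] [IsScalarTower R A M]
  [AddCommGroup N] [Module A N]

/-- An element of the dual as a linear map. -/
def Dual.toHom (f : Dual R A J) : A →ₗ[R] J := f

theorem Dual.toHom_smul (a : A) (f : Dual R A J) (x : A) : (a • f).toHom x = f.toHom (x * a) := rfl

theorem Dual.toHom_add (f g : Dual R A J) : (f + g).toHom = f.toHom + g.toHom := rfl

theorem Dual.toHom_zero : (0 : Dual R A J).toHom = 0 := rfl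

theorem Dual.ext {f g : Dual R A J} (h : ∀ x, f.toHom x = g.toHom x) : f = g :=
  LinearMap.ext h

/-- The `A`-linear map `M → DA` corresponding to an `R`-linear map `M → J`. -/
def toDual (ψ : M →ₗ[R] J) : M →ₗ[A] Dual R A J where
  toFun m := (ψ ∘ₗ (LinearMap.toSpanSingleton A M m).restrictScalars R : A →ₗ[R] J)
  map_add' m m' := Dual.ext fun x => by
    change ψ (x • (m + m')) = ψ (x • m) + ψ (x • m')
    rw [smul_add, map_add]
  map_smul' a m := Dual.ext fun x => by
    change ψ (x • a • m) = ψ ((x * a) • m)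
    rw [mul_smul]

theorem toHom_toDual (ψ : M →ₗ[R] J) (m : M) (x : A) : (toDual ψ m).toHom x = ψ (x • m) := rfl

theorem isScalarTower_compHom (R : Type u) {A : Type u} [CommRing R] [Ring A] [Algebra R A]
    (M : Type u) [AddCommGroup M] [Module A M] :
    letI := Module.compHom M (algebraMap R A)
    IsScalarTower R A M :=
  letI := Module.compHom M (algebraMap R A)
  ⟨fun r a m => by rw [Algebra.smul_def, mul_smul]; rfl⟩

/-- The `R`-linear map `M → J` corresponding to an `A`-linear map `M → DA`. -/
def ofDual (g : M →ₗ[A] Dual R A J) : M →ₗ[R] J where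
  toFun m := (g m).toHom 1
  map_add' m m' := by rw [map_add]; rfl
  map_smul' r m := by
    rw [← algebraMap_smul A r m, map_smul, Dual.toHom_smul, one_mul, Algebra.algebraMap_eq_smul_one,
      map_smul, RingHom.id_apply]

theorem ofDual_smul (g : M →ₗ[A] Dual R A J) (a : A) (m : M) :
    ofDual g (a • m) = (g m).toHom a := by
  change (g (a • m)).toHom 1 = _
  rw [map_smul, Dual.toHom_smul, one_mul]

/-- The adjunction between `A`-linear maps `X → DA` and `R`-linear maps `X → J` reduces the
extension problem to `J`. -/
instance injective_dual [Module.Injective R J] : Module.Injective A (Dual R A J) where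
  out X Y _ _ _ _ f hf g := by
    let _ : Module R X := Module.compHom X (algebraMap R A)
    let _ : Module R Y := Module.compHom Y (algebraMap R A)
    have := isScalarTower_compHom R (A := A) X
    have := isScalarTower_compHom R (A := A) Y
    obtain ⟨ψ, hψ⟩ := Module.Injective.out (f.restrictScalars R) hf (ofDual g)
    refine ⟨toDual ψ, fun x => Dual.ext fun a => ?_⟩
    rw [toHom_toDual, ← map_smul, ← ofDual_smul]
    exact hψ (a • x)

theorem exists_toDual_ne_zero [IsArtinianRing R] {j : (R ⧸ Ring.jacobson R) →ₗ[R] J}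
    (hj : IsInjectiveEnvelope R j) (x : N) (hx : x ≠ 0) :
    ∃ φ : N →ₗ[A] Dual R A J, φ x ≠ 0 := by
  let _ : Module R N := Module.compHom N (algebraMap R A)
  have := isScalarTower_compHom R (A := A) N
  obtain ⟨ψ, hψ⟩ := hj.exists_apply_ne_zero x hx
  refine ⟨toDual ψ, fun h => hψ ?_⟩
  rw [← one_smul A x, ← toHom_toDual, h, Dual.toHom_zero, LinearMap.zero_apply]

end DualModule

/-! ### From a copresentation of `A` to a presentation of `DA` -/

section DoubleCentralizer

variable {R A : Type u} [CommRing R] [Ring A] [Algebra R A] {J : Type u} [AddCommGroup J]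
  [Module R J]

variable (A) in
/-- A faithful module over which `A` is its own double centralizer. -/
structure HasDoubleCentralizer (Q : Type u) [AddCommGroup Q] [Module A Q] : Prop where
  faithful : ∀ a : A, (∀ q : Q, a • q = 0) → a = 0
  exists_smul : ∀ φ : Q → Q, (∀ (b : Q →ₗ[A] Q) (q : Q), φ (b q) = b (φ q)) →
    ∃ a : A, ∀ q, φ q = a • q

/-- Commuting with the projection to `Q₀` and with `g` forces `φ` to send `(f 1, 0)` to `(f a, 0)`
for some `a`. By injectivity every element is the image of `(f 1, 0)` under an endomorphism, so `φ`
is multiplication by `a`; additivity of `φ` is never needed. -/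
theorem hasDoubleCentralizer_of_copresentation {Q₀ Q₁ : Type u} [AddCommGroup Q₀] [Module A Q₀]
    [AddCommGroup Q₁] [Module A Q₁] [Module.Injective A (Q₀ × Q₁)] {f : A →ₗ[A] Q₀}
    {g : Q₀ →ₗ[A] Q₁} (hf : Function.Injective f) (hfg : Function.Exact f g) :
    HasDoubleCentralizer A (Q₀ × Q₁) where
  faithful a ha := hf (by
    have h := congrArg Prod.fst (ha (f 1, 0))
    rw [map_zero]
    simpa [← map_smul] using h)
  exists_smul φ hφ := by
    have h0 : φ 0 = 0 := by simpa using hφ 0 0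
    have h2 : (φ (f 1, 0)).2 = 0 := by
      have := hφ (LinearMap.inl A Q₀ Q₁ ∘ₗ LinearMap.fst A Q₀ Q₁) (f 1, 0)
      simpa using congrArg Prod.snd this
    have h1 : g (φ (f 1, 0)).1 = 0 := by
      have := hφ (LinearMap.inr A Q₀ Q₁ ∘ₗ g ∘ₗ LinearMap.fst A Q₀ Q₁) (f 1, 0)
      have h3 : (LinearMap.inr A Q₀ Q₁ ∘ₗ g ∘ₗ LinearMap.fst A Q₀ Q₁) (f 1, 0) = 0 := by
        simp [hfg.apply_apply_eq_zero]
      rw [h3, h0] at this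
      simpa using (congrArg Prod.snd this).symm
    obtain ⟨a, ha⟩ := (hfg _).1 h1
    have hp : φ (f 1, 0) = a • (f 1, 0) := Prod.ext
      (by rw [← ha, Prod.smul_fst, ← map_smul, smul_eq_mul, mul_one]) (by simp [h2])
    refine ⟨a, fun q => ?_⟩
    obtain ⟨h, hh⟩ := Module.Injective.out (LinearMap.inl A Q₀ Q₁ ∘ₗ f)
      (LinearMap.inl_injective.comp hf) (LinearMap.toSpanSingleton A _ q)
    have hq : h (f 1, 0) = q := by simpa using hh 1
    rw [← hq, hφ, hp, map_smul]

/-- Generators of the `R`-dual of `Q` assemble into `ω : Q ^ m → J`. Faithfulness makes the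
corresponding map `Q ^ m → DA` surjective, and the double centralizer property shows that its kernel
is generated by `Q`. -/
theorem exists_presentation_of_hasDoubleCentralizer [IsArtinianRing R] [Module.Finite R A]
    {j : (R ⧸ Ring.jacobson R) →ₗ[R] J} (hj : IsInjectiveEnvelope R j) (Q : Type u)
    [AddCommGroup Q] [Module A Q] [Module.Finite A Q] (hQ : HasDoubleCentralizer A Q) :
    ∃ (m n : ℕ) (g : (Fin n → Q) →ₗ[A] (Fin m → Q)) (f : (Fin m → Q) →ₗ[A] Dual R A J),
      Function.Exact g f ∧ Function.Surjective f := by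
  classical
  have : IsArtinianRing A := IsArtinianRing.of_finite R A
  let _ : Module R Q := Module.compHom Q (algebraMap R A)
  have := isScalarTower_compHom R (A := A) Q
  have : SMulCommClass A R Q := IsScalarTower.to_smulCommClass'
  have : Module.Finite R Q := Module.Finite.trans A Q
  have := hj.finite_hom (M := Q)
  obtain ⟨m, ψ, hψ⟩ := Module.Finite.exists_fin (R := R) (M := Q →ₗ[R] J)
  let ω : (Fin m → Q) →ₗ[R] J := coprodMap ψ
  let comp (θ : (Fin m → Q) →ₗ[R] J) : (Q →ₗ[A] (Fin m → Q)) →ₗ[R] (Q →ₗ[R] J) :=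
    { toFun := fun β => θ ∘ₗ β.restrictScalars R
      map_add' := fun β β' => LinearMap.ext fun q => map_add θ _ _
      map_smul' := fun r β => LinearMap.ext fun q => map_smul θ r (β q) }
  have hω : Function.Surjective (comp ω) := by
    rw [← LinearMap.range_eq_top, eq_top_iff, ← hψ, Submodule.span_le]
    rintro _ ⟨i, rfl⟩
    exact ⟨LinearMap.single A (fun _ => Q) i, coprodMap_comp_single ψ i⟩
  have hsurj : Function.Surjective (toDual (A := A) ω) := by
    let N : Submodule R (A →ₗ[R] J) :=
      { carrier := {f | ∃ k, (toDual (A := A) ω k).toHom = f}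
        add_mem' := by
          rintro _ _ ⟨k, rfl⟩ ⟨l, rfl⟩
          exact ⟨k + l, by rw [map_add, Dual.toHom_add]⟩
        zero_mem' := ⟨0, by rw [map_zero, Dual.toHom_zero]⟩
        smul_mem' := by
          rintro r _ ⟨k, rfl⟩
          refine ⟨r • k, LinearMap.ext fun x => ?_⟩
          change ω (x • r • k) = r • ω (x • k)
          rw [smul_comm, map_smul] }
    have hN : N = ⊤ := hj.eq_top_of_forall N fun a ha => hQ.faithful a fun q => by
      by_contra hq
      obtain ⟨φ, hφ⟩ := hj.exists_apply_ne_zero _ hq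
      obtain ⟨β, rfl⟩ := hω φ
      refine hφ ?_
      have : ω (a • β q) = 0 := ha (toDual (A := A) ω (β q)).toHom ⟨β q, rfl⟩
      rwa [← map_smul] at this
    intro f
    exact (hN ▸ Submodule.mem_top : f.toHom ∈ N)
  let K := LinearMap.ker (toDual (A := A) ω)
  have hK : ∀ k ∈ K, ∀ x : A, ω (x • k) = 0 := fun k hk x => by
    rw [← toHom_toDual, LinearMap.mem_ker.1 hk]
    rfl
  obtain ⟨n, h, hh⟩ := exists_hom_generators R (A := A) (M := Q) (N := K)
  let p : (Fin n → Q) →ₗ[A] (Fin m → Q) := K.subtype ∘ₗ coprodMap h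
  have hβ : ∀ β : Q →ₗ[A] (Fin m → Q), comp ω β = 0 → ∀ q, β q ∈ LinearMap.range p := by
    intro β hβ q
    have hmem : ∀ q, β q ∈ K := fun q => Dual.ext fun x => by
      rw [toHom_toDual, ← map_smul]
      exact LinearMap.congr_fun hβ (x • q)
    obtain ⟨b, hb⟩ := (hh (β.codRestrict K hmem)).2
    rw [← coprodMap_comp_pi] at hb
    exact ⟨LinearMap.pi b q, congrArg Subtype.val (LinearMap.congr_fun hb q).symm⟩
  refine ⟨m, n, p, toDual ω, fun k => ⟨fun hk => ?_, ?_⟩, hsurj⟩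
  · by_contra hkp
    -- A kernel element `k` outside the range of `p` is detected by some `θ : Q ^ m → J` vanishing
    -- on that range. It will follow that `θ = ω (a • ·)` for some `a`, which kills `k`.
    obtain ⟨θ', hθ'⟩ := hj.exists_apply_ne_zero
      (((LinearMap.range p).restrictScalars R).mkQ k) (by simpa using hkp)
    let θ := θ' ∘ₗ ((LinearMap.range p).restrictScalars R).mkQ
    have hθ : ∀ β, comp ω β = 0 → comp θ β = 0 := fun β h0 => LinearMap.ext fun q => by
      have h1 : ((LinearMap.range p).restrictScalars R).mkQ (β q) = 0 :=
        (Submodule.Quotient.mk_eq_zero _).2 (hβ β h0 q)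
      exact (congrArg θ' h1).trans (map_zero θ')
    obtain ⟨Φ, hΦ⟩ := exists_factor_through_cokernel
      (LinearMap.exact_subtype_ker_map (comp ω)) hω (comp θ)
      (LinearMap.ext fun β : LinearMap.ker (comp ω) => hθ β.1 β.2)
    have hΦ : ∀ β, Φ (comp ω β) = comp θ β := LinearMap.congr_fun hΦ
    -- Reflexivity of `Q` makes `Φ` the transpose of a function `φ` on `Q`. It commutes with
    -- endomorphisms because `comp ω` and `comp θ` are compatible with precomposition.
    choose φ hφ using fun q => hj.exists_eq_apply (LinearMap.applyₗ q ∘ₗ Φ)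
    have hφ : ∀ q χ, Φ χ q = χ (φ q) := hφ
    obtain ⟨a, ha⟩ := hQ.exists_smul φ fun b q => by
      by_contra hne
      obtain ⟨χ, hχ⟩ := hj.exists_apply_ne_zero _ (sub_ne_zero.2 hne)
      refine hχ ?_
      obtain ⟨β, rfl⟩ := hω χ
      have h1 : comp ω β (b (φ q)) = comp ω (β ∘ₗ b) (φ q) := rfl
      rw [map_sub, ← hφ, hΦ, h1, ← hφ, hΦ]
      exact sub_self _
    refine hθ' ?_
    have hθω : θ = ω ∘ₗ DistribSMul.toLinearMap R (Fin m → Q) a := by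
      refine LinearMap.pi_ext' fun i => LinearMap.ext fun q => ?_
      have h1 := hφ q (comp ω (LinearMap.single A (fun _ => Q) i))
      rw [hΦ, ha] at h1
      refine h1.trans ?_
      change ω (LinearMap.single A (fun _ => Q) i (a • q)) = ω (a • Pi.single i q)
      rw [map_smul]
      rfl
    have h2 : θ k = ω (a • k) := LinearMap.congr_fun hθω k
    exact h2.trans (hK k hk a)
  · rintro ⟨y, rfl⟩
    exact (coprodMap h y).2

theorem hasProjInjPresentation_dual [IsArtinianRing R] [Module.Finite R A]
    {j : (R ⧸ Ring.jacobson R) →ₗ[R] J} (hj : IsInjectiveEnvelope R j)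
    (h : HasProjInjCopresentation A) : HasProjInjPresentation A (Dual R A J) := by
  obtain ⟨Q₀, Q₁, f, g, hQ₀, hQ₁, hf, hfg⟩ := h
  have hQ := hQ₀.prod hQ₁
  have := hQ.injective
  have := hQ.finite
  obtain ⟨m, n, q, p, hqp, hp⟩ := exists_presentation_of_hasDoubleCentralizer hj (Q₀ × Q₁)
    (hasDoubleCentralizer_of_copresentation hf hfg)
  exact ⟨ModuleCat.of A (Fin m → Q₀ × Q₁), ModuleCat.of A (Fin n → Q₀ × Q₁), q, p,
    IsFinProjInj.pi fun _ => hQ, IsFinProjInj.pi fun _ => hQ, hqp, hp⟩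

end DoubleCentralizer

/-! ### The duality with modules over the opposite algebra -/

section OppositeDual

open MulOpposite

variable {R A B : Type u} [CommRing R] [Ring A] [Algebra R A] [Ring B] [Algebra R B]

/-- The `R`-dual of an `A`-module, to be made a module over `B` through an algebra homomorphism
from `B` to the opposite of `A`. -/
def OppDual (_σ : B →ₐ[R] Aᵐᵒᵖ) (M J : Type u) [AddCommGroup M] [Module R M] [AddCommGroup J]
    [Module R J] : Type u := M →ₗ[R] J

variable {σ : B →ₐ[R] Aᵐᵒᵖ} {τ : A →ₐ[R] Bᵐᵒᵖ} {J : Type u} [AddCommGroup J] [Module R J]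
  {M N X : Type u} [AddCommGroup M] [Module R M]
  [AddCommGroup N] [Module R N] [Module A N] [IsScalarTower R A N]
  [AddCommGroup X] [Module R X] [Module B X] [IsScalarTower R B X]

instance : AddCommGroup (OppDual σ M J) := inferInstanceAs (AddCommGroup (M →ₗ[R] J))

instance : Module R (OppDual σ M J) := inferInstanceAs (Module R (M →ₗ[R] J))

/-- An element of the dual as a linear map. -/
def OppDual.toHom (f : OppDual σ M J) : M →ₗ[R] J := f

theorem OppDual.ext {f g : OppDual σ M J} (h : ∀ x, f.toHom x = g.toHom x) : f = g :=
  LinearMap.ext h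

variable [Module A M] [IsScalarTower R A M]

/-- The action of an element of `A` as an `R`-linear map. -/
def actionHom (R : Type u) {A : Type u} [CommRing R] [Ring A] [Algebra R A] (M : Type u)
    [AddCommGroup M] [Module R M] [Module A M] [IsScalarTower R A M] (a : A) : M →ₗ[R] M where
  toFun m := a • m
  map_add' := smul_add a
  map_smul' r m := by
    rw [RingHom.id_apply, ← algebraMap_smul A r m, ← algebraMap_smul A r (a • m), ← mul_smul,
      ← mul_smul, Algebra.commutes]

instance : Module B (OppDual σ M J) where
  smul b f := f.toHom ∘ₗ actionHom R M (unop (σ b))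
  one_smul f := OppDual.ext fun x => by
    change f.toHom (unop (σ 1) • x) = f.toHom x
    rw [map_one, MulOpposite.unop_one, one_smul]
  mul_smul b c f := OppDual.ext fun x => by
    change f.toHom (unop (σ (b * c)) • x) = f.toHom (unop (σ c) • unop (σ b) • x)
    rw [map_mul, MulOpposite.unop_mul, mul_smul]
  smul_zero _ := rfl
  smul_add _ _ _ := rfl
  add_smul b c f := OppDual.ext fun x => by
    change f.toHom (unop (σ (b + c)) • x) =
      f.toHom (unop (σ b) • x) + f.toHom (unop (σ c) • x)
    rw [map_add, MulOpposite.unop_add, add_smul, map_add]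
  zero_smul f := OppDual.ext fun x => by
    change f.toHom (unop (σ 0) • x) = 0
    rw [map_zero, MulOpposite.unop_zero, zero_smul, map_zero]

theorem OppDual.toHom_smul (b : B) (f : OppDual σ M J) (x : M) :
    (b • f).toHom x = f.toHom (unop (σ b) • x) := rfl

instance : IsScalarTower R B (OppDual σ M J) where
  smul_assoc r b f := OppDual.ext fun x => by
    change f.toHom (unop (σ (r • b)) • x) = r • f.toHom (unop (σ b) • x)
    rw [map_smul σ, MulOpposite.unop_smul, smul_assoc, map_smul f.toHom]

/-- The dual of a linear map. -/
def OppDual.map (σ : B →ₐ[R] Aᵐᵒᵖ) (J : Type u) [AddCommGroup J] [Module R J] (f : M →ₗ[A] N) :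
    OppDual σ N J →ₗ[B] OppDual σ M J where
  toFun θ := θ.toHom ∘ₗ f.restrictScalars R
  map_add' _ _ := rfl
  map_smul' b θ := OppDual.ext fun x => by
    change θ.toHom (unop (σ b) • f x) = θ.toHom (f (unop (σ b) • x))
    rw [map_smul f]

theorem OppDual.toHom_map (f : M →ₗ[A] N) (θ : OppDual σ N J) (x : M) :
    (OppDual.map σ J f θ).toHom x = θ.toHom (f x) := rfl

/-- The self-adjointness of the duality. -/
def OppDual.flip (τ : A →ₐ[R] Bᵐᵒᵖ) (h : ∀ a, unop (σ (unop (τ a))) = a)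
    (g : X →ₗ[B] OppDual σ M J) : M →ₗ[A] OppDual τ X J where
  toFun m :=
    { toFun := fun x => (g x).toHom m
      map_add' := fun x y => by rw [map_add]; rfl
      map_smul' := fun r x => by
        rw [← algebraMap_smul B r x, map_smul, algebraMap_smul]; rfl }
  map_add' m m' := OppDual.ext fun x => map_add (g x).toHom m m'
  map_smul' a m := OppDual.ext fun x => by
    change (g x).toHom (a • m) = (g (unop (τ a) • x)).toHom m
    rw [map_smul g, OppDual.toHom_smul, h]

theorem OppDual.toHom_flip (h : ∀ a, unop (σ (unop (τ a))) = a) (g : X →ₗ[B] OppDual σ M J)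
    (m : M) (x : X) : (OppDual.flip τ h g m).toHom x = (g x).toHom m := rfl

/-- The dual of a projective module is injective. -/
theorem OppDual.injective [Module.Injective R J] [Module.Projective A M]
    (hτ : ∀ a, unop (σ (unop (τ a))) = a) (hσ : ∀ b, unop (τ (unop (σ b))) = b) :
    Module.Injective B (OppDual σ M J) where
  out X Y _ _ _ _ f hf g := by
    let _ : Module R X := Module.compHom X (algebraMap R B)
    let _ : Module R Y := Module.compHom Y (algebraMap R B)
    have := isScalarTower_compHom R (A := B) X
    have := isScalarTower_compHom R (A := B) Y
    have hsurj : Function.Surjective (OppDual.map τ J f) := fun θ => by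
      obtain ⟨ψ, hψ⟩ := Module.Injective.out (f.restrictScalars R) hf θ.toHom
      exact ⟨ψ, OppDual.ext hψ⟩
    -- The extension problem for `g` is transposed into a lifting problem out of the projective
    -- module `M`.
    obtain ⟨k, hk⟩ := Module.projective_lifting_property _ (OppDual.flip τ hτ g) hsurj
    refine ⟨OppDual.flip σ hσ k, fun x => OppDual.ext fun m => ?_⟩
    rw [OppDual.toHom_flip, ← OppDual.toHom_flip hτ g, ← hk]
    rfl

variable [IsArtinianRing R] [Module.Finite R A] {j : (R ⧸ Ring.jacobson R) →ₗ[R] J}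

theorem OppDual.finite (hj : IsInjectiveEnvelope R j) [Module.Finite A M] :
    Module.Finite B (OppDual σ M J) := by
  have : Module.Finite R M := Module.Finite.trans A M
  have : Module.Finite R (OppDual σ M J) := hj.finite_hom (M := M)
  exact Module.Finite.of_restrictScalars_finite R B _

/-- The dual of a finitely generated injective module is projective. -/
theorem OppDual.projective [Module.Finite R B] (hj : IsInjectiveEnvelope R j) [Module.Finite A M]
    [Module.Injective A M] (hτ : ∀ a, unop (σ (unop (τ a))) = a)
    (hσ : ∀ b, unop (τ (unop (σ b))) = b) : Module.Projective B (OppDual σ M J) := by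
  have := OppDual.finite (σ := σ) hj (M := M)
  obtain ⟨k, p, hp⟩ := Module.Finite.exists_fin' B (OppDual σ M J)
  have hinj : Function.Injective (OppDual.flip τ hτ p) := by
    rw [← LinearMap.ker_eq_bot, Submodule.eq_bot_iff]
    intro m hm
    by_contra hm0
    obtain ⟨θ, hθ⟩ := hj.exists_apply_ne_zero m hm0
    obtain ⟨y, hy⟩ := hp θ
    refine hθ ?_
    have h1 : (p y).toHom m = 0 := by
      rw [← OppDual.toHom_flip hτ p, LinearMap.mem_ker.1 hm]
      rfl
    rw [hy] at h1
    exact h1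
  -- The transpose of `p` embeds the injective `M` in the dual of a free module, so it splits.
  -- Dualizing the retraction `r` and using reflexivity of the free module splits `p`.
  obtain ⟨r, hr⟩ := Module.Injective.out (OppDual.flip τ hτ p) hinj LinearMap.id
  let ev : (Fin k → B) →ₗ[B] OppDual σ (OppDual τ (Fin k → B) J) J :=
    OppDual.flip σ hσ LinearMap.id
  have hev : Function.Bijective ev := by
    constructor
    · rw [← LinearMap.ker_eq_bot, Submodule.eq_bot_iff]
      intro y hy
      by_contra hy0
      obtain ⟨f, hf⟩ := hj.exists_apply_ne_zero y hy0
      refine hf ?_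
      have h1 : (ev y).toHom f = 0 := by
        rw [LinearMap.mem_ker.1 hy]
        rfl
      exact h1
    · intro F
      obtain ⟨y, hy⟩ := hj.exists_eq_apply (M := Fin k → B) F.toHom
      exact ⟨y, OppDual.ext fun f => (hy f).symm⟩
  let e := LinearEquiv.ofBijective ev hev
  refine Module.Projective.of_split (e.symm.toLinearMap ∘ₗ OppDual.map σ J r) p
    (LinearMap.ext fun θ => OppDual.ext fun m => ?_)
  have h1 : ev (e.symm (OppDual.map σ J r θ)) = OppDual.map σ J r θ := e.apply_symm_apply _
  have h2 := congrArg (fun F => F.toHom (OppDual.flip τ hτ p m)) h1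
  simp only [OppDual.toHom_map, hr] at h2
  exact h2

/-- Dualize the presentation: `D(DA)` is identified with `B` by evaluation, and Matlis reflexivity
of `A` gives exactness. Mutually inverse `σ` and `τ`, instead of `B = Aᵐᵒᵖ`, allow the passage back
from `Λᵐᵒᵖ` to `Λ` itself. -/
theorem hasProjInjCopresentation_opposite [Module.Finite R B] (hj : IsInjectiveEnvelope R j)
    (σ : B →ₐ[R] Aᵐᵒᵖ)
    (τ : A →ₐ[R] Bᵐᵒᵖ) (hτ : ∀ a, unop (σ (unop (τ a))) = a)
    (hσ : ∀ b, unop (τ (unop (σ b))) = b) (h : HasProjInjPresentation A (Dual R A J)) :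
    HasProjInjCopresentation B := by
  obtain ⟨Q₀, Q₁, g, f, hQ₀, hQ₁, hgf, hf⟩ := h
  have := hj.injective_module
  let _ : Module R Q₀ := Module.compHom Q₀ (algebraMap R A)
  let _ : Module R Q₁ := Module.compHom Q₁ (algebraMap R A)
  have := isScalarTower_compHom R (A := A) Q₀
  have := isScalarTower_compHom R (A := A) Q₁
  have hPI : ∀ (Q : ModuleCat.{u} A) [Module R Q] [IsScalarTower R A Q], IsFinProjInj A Q →
      IsFinProjInj B (OppDual σ Q J) := fun Q _ _ hQ =>
    have := hQ.finite
    have := hQ.injective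
    have := hQ.projective
    ⟨OppDual.finite hj, OppDual.projective hj hτ hσ, OppDual.injective hτ hσ⟩
  let fR : Q₀ →ₗ[R] (A →ₗ[R] J) :=
    { toFun := fun q => (f q).toHom
      map_add' := fun q q' => by rw [map_add, Dual.toHom_add]
      map_smul' := fun r q => LinearMap.ext fun x => by
        rw [← algebraMap_smul A r q, map_smul, Dual.toHom_smul, ← Algebra.commutes,
          ← Algebra.smul_def, map_smul]
        rfl }
  have hexR : Function.Exact (g.restrictScalars R) fR := hgf
  have hfR : Function.Surjective fR := hf
  -- The dual of `Q₀ → DA` preceded by the evaluation map of `B` into `D(DA)`.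
  let F : B →ₗ[B] OppDual σ Q₀ J :=
    { toFun := fun b => LinearMap.applyₗ (unop (σ b)) ∘ₗ fR
      map_add' := fun b c => OppDual.ext fun q => by
        change (f q).toHom (unop (σ (b + c))) = (f q).toHom _ + (f q).toHom _
        rw [map_add, MulOpposite.unop_add, map_add]
      map_smul' := fun b c => OppDual.ext fun q => by
        change (f q).toHom (unop (σ (b * c))) = (f (unop (σ b) • q)).toHom (unop (σ c))
        rw [map_smul, Dual.toHom_smul, map_mul, MulOpposite.unop_mul] }
  have hF : ∀ b q, (F b).toHom q = (f q).toHom (unop (σ b)) := fun _ _ => rfl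
  refine ⟨ModuleCat.of B (OppDual σ Q₀ J), ModuleCat.of B (OppDual σ Q₁ J), F, OppDual.map σ J g,
    hPI Q₀ hQ₀, hPI Q₁ hQ₁, ?_, fun θ => ⟨fun hθ => ?_, ?_⟩⟩
  · rw [← LinearMap.ker_eq_bot, Submodule.eq_bot_iff]
    intro b hb
    have h0 : unop (σ b) = 0 := by
      by_contra hne
      obtain ⟨ψ, hψ⟩ := hj.exists_apply_ne_zero _ hne
      obtain ⟨q, hq⟩ := hf ψ
      refine hψ ?_
      have h1 : (f q).toHom (unop (σ b)) = 0 := by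
        rw [← hF, LinearMap.mem_ker.1 hb]
        rfl
      rw [hq] at h1
      exact h1
    rw [← hσ b, h0, map_zero, MulOpposite.unop_zero]
  · obtain ⟨v, hv⟩ := exists_factor_through_cokernel hexR hfR θ.toHom hθ
    obtain ⟨a, ha⟩ := hj.exists_eq_apply v
    refine ⟨unop (τ a), OppDual.ext (σ := σ) (M := Q₀) fun q => ?_⟩
    rw [hF, hτ, ← hv]
    exact (ha (fR q)).symm
  · rintro ⟨b, rfl⟩
    refine OppDual.ext (σ := σ) (M := Q₁) fun q => ?_
    rw [OppDual.toHom_map, hF, hgf.apply_apply_eq_zero]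
    rfl

end OppositeDual

/-! ### Assembling the equivalences -/

section Main

theorem two_le_domDim_iff_exists_isTilting (R A : Type u) [CommRing R] [IsArtinianRing R] [Ring A]
    [Algebra R A] [Module.Finite R A] :
    2 ≤ domDim A ↔ ∃ T : ModuleCat.{u} A, MemC A T ∧ IsTilting A T := by
  have : IsArtinianRing A := IsArtinianRing.of_finite R A
  rw [two_le_domDim_iff]
  exact ⟨exists_isTilting_of_hasProjInjCopresentation A,
    fun ⟨_, hC, hT⟩ => hasProjInjCopresentation_of_isTilting A R hC hT⟩

variable (R A : Type u) [CommRing R] [IsArtinianRing R] [Ring A] [Algebra R A] [Module.Finite R A]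

theorem exists_isCotilting {J : ModuleCat.{u} R} {j : (R ⧸ Ring.jacobson R) →ₗ[R] J}
    (hj : IsInjectiveEnvelope R j) (h : HasProjInjPresentation A (Dual R A J)) :
    ∃ C : ModuleCat.{u} A, MemC A C ∧ IsCotilting R A C := by
  have : IsArtinianRing A := IsArtinianRing.of_finite R A
  have := hj.injective_module
  obtain ⟨C, hC, hid, hext, hres⟩ := exists_of_hasProjInjPresentation h
  exact ⟨C, hC, hC.1, hid, hext, J, j, hj, hres⟩

theorem hasProjInjPresentation_of_isCotilting {C : ModuleCat.{u} A} (hC : MemC A C)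
    (hC' : IsCotilting R A C) : ∃ (J : ModuleCat.{u} R) (j : (R ⧸ Ring.jacobson R) →ₗ[R] J),
      IsInjectiveEnvelope R j ∧ HasProjInjPresentation A (Dual R A J) := by
  obtain ⟨_, t, Q, hQ, hgen, hcogen⟩ := hC
  obtain ⟨J, j, hj, C₀, C₁, f, g, hC₀, hC₁, hf, hfg, hg⟩ := hC'.exists_resolution
  have := hj.injective_module
  exact ⟨J, j, hj, hasProjInjPresentation_of_extZero R hQ.isFinProjInj hgen hcogen
    (fun _ x hx => exists_toDual_ne_zero hj x hx) hf hfg hg hC₀ hC₁ hC'.ext_eq_zero⟩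

end Main

end ArtinTilting

theorem mainTheorem2 (R Λ : Type u) [CommRing R] [IsArtinianRing R] [Ring Λ] [Algebra R Λ]
    [Module.Finite R Λ] :
    List.TFAE [
      2 ≤ ArtinTilting.domDim Λ,
      ∃ T : ModuleCat.{u} Λ, ArtinTilting.MemC Λ T ∧ ArtinTilting.IsTilting Λ T,
      ∃ C : ModuleCat.{u} Λ, ArtinTilting.MemC Λ C ∧ ArtinTilting.IsCotilting R Λ C,
      ∃ T : ModuleCat.{u} Λᵐᵒᵖ, ArtinTilting.MemC Λᵐᵒᵖ T ∧ ArtinTilting.IsTilting Λᵐᵒᵖ T,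
      2 ≤ ArtinTilting.domDim Λᵐᵒᵖ] := by
  have : IsArtinianRing Λ := IsArtinianRing.of_finite R Λ
  have : Module.Finite R Λᵐᵒᵖ := Module.Finite.equiv (MulOpposite.opLinearEquiv R)
  have : IsArtinianRing Λᵐᵒᵖ := IsArtinianRing.of_finite R Λᵐᵒᵖ
  tfae_have 1 ↔ 2 := ArtinTilting.two_le_domDim_iff_exists_isTilting R Λ
  tfae_have 5 ↔ 4 := ArtinTilting.two_le_domDim_iff_exists_isTilting R Λᵐᵒᵖ
  tfae_have 1 → 3 := fun h => by
    obtain ⟨J, j, hj⟩ := ArtinTilting.exists_isInjectiveEnvelope R (R ⧸ Ring.jacobson R)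
    exact ArtinTilting.exists_isCotilting R Λ hj (ArtinTilting.hasProjInjPresentation_dual hj
      ((ArtinTilting.two_le_domDim_iff Λ).1 h))
  tfae_have 3 → 5 := fun ⟨C, hC, hC'⟩ => by
    obtain ⟨J, j, hj, h⟩ := ArtinTilting.hasProjInjPresentation_of_isCotilting R Λ hC hC'
    exact (ArtinTilting.two_le_domDim_iff Λᵐᵒᵖ).2
      (ArtinTilting.hasProjInjCopresentation_opposite hj (AlgHom.id R Λᵐᵒᵖ)
        (AlgEquiv.opOp R Λ).toAlgHom (fun _ => rfl) (fun _ => rfl) h)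
  tfae_have 5 → 1 := fun h => by
    obtain ⟨J, j, hj⟩ := ArtinTilting.exists_isInjectiveEnvelope R (R ⧸ Ring.jacobson R)
    exact (ArtinTilting.two_le_domDim_iff Λ).2
      (ArtinTilting.hasProjInjCopresentation_opposite hj (AlgEquiv.opOp R Λ).toAlgHom
        (AlgHom.id R Λᵐᵒᵖ) (fun _ => rfl) (fun _ => rfl)
        (ArtinTilting.hasProjInjPresentation_dual hj
          ((ArtinTilting.two_le_domDim_iff Λᵐᵒᵖ).1 h)))
  tfae_finish
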